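/- **Setting.** $N\ge1$ clients act in round-robin order: client $i_t=((t-1)\bmod N)+1$ acts at time $t$. Let $\mathcal X\subseteq[0,1]^{d_x}$ be measurable of positive volume with uniform distribution $\mathcal U$, let $\mathcal W\subseteq[0,1]^{d_w}$ be compact and convex, and let $f:(x,w)\mapsto f_x(w)$ be measurable. Observations are $y=f_x(w^\star)+\eta$, where the noise is zero-mean, $\sigma$-sub-Gaussian and independent of the past. **Assumptions.** 1. (Realizability) $w^\star\in\mathcal W$. 2. (Boundedness, smoothness) For $x\in\mathcal X$, $w\in\mathcal W$, $f_x$ is twice differentiable at $w$ with $|f_x(w)|\le F$, $\|\nabla f_x(w)\|_2\le C_g$, $\|\nabla^2f_x(w)\|_{\rm op}\le C_h$, where $F\ge1$ and $C_g,C_h>0$. 3. (Geometry of the loss) $L(w)=\mathbb E_{x\sim\mathcal U}(f_x(w)-f_x(w^\star))^2$ is twice differentiable on $\mathcal W$, and for constants $0<\mu<d_w$, $\tau>0$, $0<\gamma<2$, $0<c<1$, $\zeta>0$, $C_i,C_j>0$ and all $w\in\mathcal W$: $\min\{\frac\mu2\|w-w^\star\|_2^2,\frac\tau2\|w-w^\star\|_2^\gamma\}\le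 L(w)-L(w^\star)$; $\nabla L(w)^\top w\ge C_i\|w\|_2^2-C_j$; $(1-c)^2\nabla^2L(w^\star)\preceq\nabla^2L(w)\preceq(1-c)^{-2}\nabla^2L(w^\star)$ whenever $\|w-w^\star\|^2_{\nabla^2L(w^\star)}\le c^2$; and $\|\nabla^2L(w^\star)\|_{\rm op}\le\zeta$. **Algorithm (Fed-GO-UCB).** *Phase I:* $T_0=\lceil\sqrt{NT}\,\rceil$ independent points are drawn from $\mathcal U$ and observed with noise independent across samples and of the points. The oracle returns $\hat w_0\in\mathcal W$ whose average squared error on these data is, almost surely, within $\epsilon$ of the minimum over $\mathcal W$. *Phase II*, $t=1,\dots,NT$. Let $\nabla_s=\nabla f_{x_s}(\hat w_0)$ (gradient in the parameter), $\lambda=C_\lambda\sqrt{NT}$. For a set $D$ of time steps put $$\Sigma(D)=\lambda I+\sum_{s\in D}\nabla_s\nabla_s^\top,\quad b(D)=\sum_{s\in D}\nabla_s\big(\nabla_s^\top\hat w_0+y_s-f_{x_s}(\hat w_0)\big),\quad \hat w(D)=\Sigma(D)^{-1}b(D)+\lambda\Sigma(D)^{-1}\hat w_0,$$ $$\mathrm{Ball}(D)=\{w:\|w-\hat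 w(D)\|^2_{\Sigma(D)}\le\beta\}.$$ Client $i$ holds a data index set $D_{t,i}$, with $D_{0,i}=\emptyset$. At time $t$, client $i_t$ queries $x_t\in\mathcal X$ maximizing $\max_{w\in\mathrm{Ball}(D_{t-1,i_t})\cap\mathcal W}f_x(w)$ (any $x_t\in\mathcal X$ if this intersection is empty; the choice depends only on the past), observes $y_t$, and sets $D_{t,i_t}=D_{t-1,i_t}\cup\{t\}$. If then $(|D_{t,i_t}|-|D_{t_{\rm last},i_t}|)\log\frac{\det\Sigma(D_{t,i_t})}{\det(\Sigma(D_{t,i_t})-\Delta\Sigma)}$ exceeds a fixed communication threshold (an arbitrary real number), where $t_{\rm last}$ is the last synchronization time ($0$ if none) and $\Delta\Sigma=\sum_{s\in D_{t,i_t}\setminus D_{t_{\rm last},i_t}}\nabla_s\nabla_s^\top$, a synchronization takes place: every client's index set becomes the union of all clients' index sets. **Claim.** There is a universal $k\in\mathbb N$ such that for all $C_h,C_\lambda,\kappa,C'>0$ there is $C>0$, depending only on these four numbers, with the following property. For all $N,T\ge1$, $d_x,d_w$, $\delta\in(0,1)$ and every problem as above with $\sigma\le\kappa F$, put $\iota=\log\frac{3NTd_w(1+C_g)}{\delta}$.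 If $$\epsilon\le\frac1{C'T_0},\qquad T_0\ge C\,d_wF^2\iota\,\max\Big\{\frac{\mu^{\gamma/(2-\gamma)}}{\tau^{2/(2-\gamma)}},\frac{\zeta}{\mu c^2}\Big\},$$ and the algorithm is run with $$\beta_{t,i_t}=\beta=C\Big(d_w\sigma^2+\frac{d_wF^2}{\mu}+\frac{d_w^3F^4}{\mu^2}\Big)\iota^k,$$ then with probability at least $1-\delta$, simultaneously for all $t\in\{1,\dots,NT\}$, $$\|\hat w_{t,i_t}-w^\star\|^2_{\Sigma_{t,i_t}}\le\beta_{t,i_t},$$ where $\hat w_{t,i_t},\Sigma_{t,i_t}$ are the estimate and matrix of client $i_t$ after its local update at time $t$. The same bound holds for the statistics of every client at the end of time step $t$ (after a possible synchronization). -/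

import Mathlib

open MeasureTheory ProbabilityTheory
open scoped NNReal ENNReal

noncomputable section

namespace FedGOUCB

/-- Points and parameters live in Euclidean spaces. -/
abbrev Vec (d : ℕ) := EuclideanSpace ℝ (Fin d)

/-- The unit cube `[0,1]^d`. -/
def unitCube (d : ℕ) : Set (Vec d) := {v | ∀ j, 0 ≤ v j ∧ v j ≤ 1}

/-- The uniform distribution on a set of positive finite volume. -/
def uniformLaw {d : ℕ} (X : Set (Vec d)) : Measure (Vec d) :=
  ProbabilityTheory.cond volume X

/-- The quadratic form `vᵀ A v`, i.e. `‖v‖²_A`. -/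
def sqNorm {d : ℕ} (A : Matrix (Fin d) (Fin d) ℝ) (v : Vec d) : ℝ :=
  v.ofLp ⬝ᵥ A.mulVec v.ofLp

/-! ### Assumptions on the model -/

/-- The domain: a measurable subset of the unit cube that carries a uniform distribution. -/
structure IsDomainSet {dx : ℕ} (X : Set (Vec dx)) : Prop where
  measurableSet : MeasurableSet X
  subset_cube : X ⊆ unitCube dx
  volume_ne_zero : volume X ≠ 0

/-- Realizability: the unknown function is `f · wstar` with `wstar` in the compact convex parameter
set `W ⊆ [0,1]^dw`. -/
structure Realizable {dw : ℕ} (W : Set (Vec dw)) (wstar : Vec dw) : Prop where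
  isCompact : IsCompact W
  convex : Convex ℝ W
  subset_cube : W ⊆ unitCube dw
  mem : wstar ∈ W

/-- The functions `f x` are twice differentiable at the points of `W`, with values, gradients and
Hessians bounded by `F`, `Cg`, `Ch`. -/
structure BoundedSmooth {dx dw : ℕ} (X : Set (Vec dx)) (W : Set (Vec dw))
    (f : Vec dx → Vec dw → ℝ) (F Cg Ch : ℝ) : Prop where
  measurable : Measurable (Function.uncurry f)
  differentiableAt : ∀ x ∈ X, ∀ w ∈ W, DifferentiableAt ℝ (f x) w
  differentiableAt_fderiv : ∀ x ∈ X, ∀ w ∈ W, DifferentiableAt ℝ (fderiv ℝ (f x)) w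
  abs_le : ∀ x ∈ X, ∀ w ∈ W, |f x w| ≤ F
  norm_gradient_le : ∀ x ∈ X, ∀ w ∈ W, ‖gradient (f x) w‖ ≤ Cg
  norm_hessian_le : ∀ x ∈ X, ∀ w ∈ W, ‖fderiv ℝ (fderiv ℝ (f x)) w‖ ≤ Ch

/-- The expected loss `L(w) = E_{x ∼ U(X)} (f_x(w) - f_x(w⋆))²`. -/
def expectedLoss {dx dw : ℕ} (X : Set (Vec dx)) (f : Vec dx → Vec dw → ℝ) (wstar w : Vec dw) : ℝ :=
  ∫ x, (f x w - f x wstar) ^ 2 ∂(uniformLaw X)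

/-- The Hessian of `L` at `w` as a quadratic form. -/
def hessForm {dw : ℕ} (L : Vec dw → ℝ) (w v : Vec dw) : ℝ :=
  fderiv ℝ (fderiv ℝ L) w v v

/-- Geometric conditions on the loss: growth / local strong convexity, dissipativity, and
`c`-local self-concordance at `wstar`; `ζ` bounds the Hessian at `wstar`. -/
structure GeometricLoss {dw : ℕ} (L : Vec dw → ℝ) (W : Set (Vec dw)) (wstar : Vec dw)
    (μ τ γ c ζ : ℝ) : Prop where
  μ_pos : 0 < μ
  μ_lt : μ < dw
  τ_pos : 0 < τ
  γ_pos : 0 < γ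
  γ_lt : γ < 2
  c_pos : 0 < c
  c_lt : c < 1
  ζ_pos : 0 < ζ
  differentiableAt : ∀ w ∈ W, DifferentiableAt ℝ L w
  differentiableAt_fderiv : ∀ w ∈ W, DifferentiableAt ℝ (fderiv ℝ L) w
  growth : ∀ w ∈ W,
    min (μ / 2 * ‖w - wstar‖ ^ 2) (τ / 2 * ‖w - wstar‖ ^ γ) ≤ L w - L wstar
  dissipative : ∃ Ci Cj : ℝ, 0 < Ci ∧ 0 < Cj ∧
    ∀ w ∈ W, Ci * ‖w‖ ^ 2 - Cj ≤ inner ℝ (gradient L w) w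
  selfConcordant : ∀ w ∈ W, hessForm L wstar (w - wstar) ≤ c ^ 2 → ∀ v,
    (1 - c) ^ 2 * hessForm L wstar v ≤ hessForm L w v ∧
      hessForm L w v ≤ ((1 - c) ^ 2)⁻¹ * hessForm L wstar v
  norm_hessian_le : ‖fderiv ℝ (fderiv ℝ L) wstar‖ ≤ ζ

/-! ### Phase I: the empirical loss -/

/-- Squared-error loss on the data of client `i`. The clients take turns; the sample with
zero-based index `s` belongs to client `s mod N`. -/
def localLoss {dx dw T₀ : ℕ} (N : ℕ) [NeZero N] (f : Vec dx → Vec dw → ℝ)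
    (x : Fin T₀ → Vec dx) (y : Fin T₀ → ℝ) (i : Fin N) (w : Vec dw) : ℝ :=
  ∑ s with Fin.ofNat N s.val = i, (y s - f (x s) w) ^ 2

/-- The global empirical loss. -/
def empiricalLoss {dx dw T₀ : ℕ} (N : ℕ) [NeZero N] (f : Vec dx → Vec dw → ℝ)
    (x : Fin T₀ → Vec dx) (y : Fin T₀ → ℝ) (w : Vec dw) : ℝ :=
  (1 / (T₀ : ℝ)) * ∑ i : Fin N, localLoss N f x y i w

/-- `w₀` is an `ε`-approximate minimizer of `Lhat` over `W`. -/
def IsApproxMinimizer {dw : ℕ} (Lhat : Vec dw → ℝ) (W : Set (Vec dw)) (ε : ℝ) (w₀ : Vec dw) :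
    Prop :=
  w₀ ∈ W ∧ ∃ v ∈ W, IsMinOn Lhat W v ∧ |Lhat w₀ - Lhat v| ≤ ε

/-! ### Phase II: statistics, confidence sets and communication -/

/-- What Phase II sees: the shared Phase I model, the queries `x t` and the observations `y t`
(time steps are `t = 1, 2, …`). -/
structure Trajectory (dx dw : ℕ) where
  w₀ : Vec dw
  x : ℕ → Vec dx
  y : ℕ → ℝ

variable {dx dw : ℕ}

/-- Gradient of the model in the parameter, at the query `x s` and the shared model `w₀`. -/
def Trajectory.grad (h : Trajectory dx dw) (f : Vec dx → Vec dw → ℝ) (s : ℕ) : Vec dw :=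
  gradient (f (h.x s)) h.w₀

/-- `∑_{s ∈ D} ∇_s ∇_sᵀ`. -/
def Trajectory.gram (h : Trajectory dx dw) (f : Vec dx → Vec dw → ℝ) (D : Finset ℕ) :
    Matrix (Fin dw) (Fin dw) ℝ :=
  ∑ s ∈ D, Matrix.vecMulVec (h.grad f s).ofLp (h.grad f s).ofLp

/-- `Σ = lam I + ∑_{s ∈ D} ∇_s ∇_sᵀ`. -/
def Trajectory.sigma (h : Trajectory dx dw) (f : Vec dx → Vec dw → ℝ) (lam : ℝ) (D : Finset ℕ) :
    Matrix (Fin dw) (Fin dw) ℝ :=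
  lam • (1 : Matrix (Fin dw) (Fin dw) ℝ) + h.gram f D

/-- `b = ∑_{s ∈ D} ∇_s (∇_sᵀ w₀ + y_s - f_{x_s}(w₀))`. -/
def Trajectory.bvec (h : Trajectory dx dw) (f : Vec dx → Vec dw → ℝ) (D : Finset ℕ) : Vec dw :=
  ∑ s ∈ D, (inner ℝ (h.grad f s) h.w₀ + h.y s - f (h.x s) h.w₀) • h.grad f s

/-- The estimate `Σ⁻¹ b + lam Σ⁻¹ w₀` computed from the data indexed by `D`. -/
def Trajectory.estimate (h : Trajectory dx dw) (f : Vec dx → Vec dw → ℝ) (lam : ℝ)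
    (D : Finset ℕ) : Vec dw :=
  WithLp.toLp 2 ((h.sigma f lam D)⁻¹.mulVec (h.bvec f D).ofLp
    + lam • (h.sigma f lam D)⁻¹.mulVec h.w₀.ofLp)

/-- The confidence ellipsoid `{w : ‖w - ŵ‖²_Σ ≤ β}` computed from the data indexed by `D`. -/
def Trajectory.ball (h : Trajectory dx dw) (f : Vec dx → Vec dw → ℝ) (lam β : ℝ)
    (D : Finset ℕ) : Set (Vec dw) :=
  {w | sqNorm (h.sigma f lam D) (w - h.estimate f lam D) ≤ β}

/-- The client acting at time `t ≥ 1` (round robin). -/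
def clientAt (N : ℕ) [NeZero N] (t : ℕ) : Fin N := Fin.ofNat N (t - 1)

/-- For each client `i`: the time steps `cur i` of the data behind its current statistics, and the
time steps `last i` of the data behind its statistics right after the last synchronization. The
data not yet uploaded are those in `cur i \ last i`. -/
structure ClientSets (N : ℕ) where
  cur : Fin N → Finset ℕ
  last : Fin N → Finset ℕ

/-- At time `t` the acting client includes its new data point. -/
def ClientSets.localUpdate {N : ℕ} [NeZero N] (S : ClientSets N) (t : ℕ) : ClientSets N where
  cur := Function.update S.cur (clientAt N t) (insert t (S.cur (clientAt N t)))
  last := S.last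

/-- The event that triggers a synchronization, for client `i`:
`(|D| - |D_last|) log (det Σ / det (Σ - ΔΣ)) > thr`. -/
def Trajectory.triggered (h : Trajectory dx dw) (f : Vec dx → Vec dw → ℝ) (lam thr : ℝ) {N : ℕ}
    (S : ClientSets N) (i : Fin N) : Prop :=
  thr < (((S.cur i).card : ℝ) - ((S.last i).card : ℝ)) *
    Real.log ((h.sigma f lam (S.cur i)).det /
      (h.sigma f lam (S.cur i) - h.gram f (S.cur i \ S.last i)).det)

/-- Synchronization: the server gathers the data of all clients and sends the aggregate back. -/
def ClientSets.synchronize {N : ℕ} (S : ClientSets N) : ClientSets N where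
  cur := fun _ => Finset.univ.biUnion S.cur
  last := fun _ => Finset.univ.biUnion S.cur

open Classical in
/-- The index sets of the clients at the end of time step `t` of Phase II. -/
def Trajectory.clientSets (h : Trajectory dx dw) (f : Vec dx → Vec dw → ℝ) (lam thr : ℝ)
    (N : ℕ) [NeZero N] : ℕ → ClientSets N
  | 0 => ⟨fun _ => ∅, fun _ => ∅⟩
  | t + 1 =>
    let S := (h.clientSets f lam thr N t).localUpdate (t + 1)
    if h.triggered f lam thr S (clientAt N (t + 1)) then S.synchronize else S

/-- The index set of the acting client at time `t ≥ 1`, right after its local update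
(and before a possible synchronization). -/
def Trajectory.activeSet (h : Trajectory dx dw) (f : Vec dx → Vec dw → ℝ) (lam thr : ℝ)
    (N : ℕ) [NeZero N] (t : ℕ) : Finset ℕ :=
  ((h.clientSets f lam thr N (t - 1)).localUpdate t).cur (clientAt N t)

/-- Optimistic choice: `x` maximizes `max_{w ∈ B ∩ W} f x w` over `X` (if `B ∩ W` is empty, any
`x ∈ X` may be chosen). -/
def IsOptimistic (f : Vec dx → Vec dw → ℝ) (X : Set (Vec dx)) (W B : Set (Vec dw)) (x : Vec dx) :
    Prop :=
  x ∈ X ∧ ((B ∩ W).Nonempty → ∃ w ∈ B ∩ W, ∀ x' ∈ X, ∀ w' ∈ B ∩ W, f x' w' ≤ f x w)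

/-- The trajectory of Phase II on the outcome `ω`. -/
def trajectoryAt {Ω : Type*} (f : Vec dx → Vec dw → ℝ) (wstar : Vec dw) (w₀ : Ω → Vec dw)
    (x : ℕ → Ω → Vec dx) (η : ℕ → Ω → ℝ) (ω : Ω) : Trajectory dx dw where
  w₀ := w₀ ω
  x := fun t => x t ω
  y := fun t => f (x t ω) wstar + η t ω

/-- A random run of the algorithm with `N` clients, `T` rounds in Phase II, `T₀` samples in Phase I,
regularization `lam`, communication threshold `thr`, radius `β` and oracle accuracy `ε`.
`ℱ t` is the information available after time `t` of Phase II. -/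
structure IsRun {Ω : Type*} {mΩ : MeasurableSpace Ω} (P : Measure Ω) (ℱ : Filtration ℕ mΩ)
    (X : Set (Vec dx)) (W : Set (Vec dw)) (f : Vec dx → Vec dw → ℝ) (wstar : Vec dw) (σ : ℝ≥0)
    (N T T₀ : ℕ) [NeZero N] (lam thr β ε : ℝ)
    (x₁ : Fin T₀ → Ω → Vec dx) (η₁ : Fin T₀ → Ω → ℝ) (w₀ : Ω → Vec dw)
    (x : ℕ → Ω → Vec dx) (η : ℕ → Ω → ℝ) : Prop where
  /-- Phase I: independent uniform queries with independent sub-Gaussian noise. -/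
  x₁_measurable : ∀ s, Measurable[ℱ 0] (x₁ s)
  η₁_measurable : ∀ s, Measurable[ℱ 0] (η₁ s)
  x₁_law : ∀ s, P.map (x₁ s) = uniformLaw X
  η₁_mean : ∀ s, ∫ ω, η₁ s ω ∂P = 0
  η₁_subgaussian : ∀ s, HasSubgaussianMGF (η₁ s) (σ ^ 2) P
  indep_samples : iIndepFun (fun s ω => (x₁ s ω, η₁ s ω)) P
  indep_noise : ∀ s, IndepFun (x₁ s) (η₁ s) P
  /-- The oracle returns an approximate minimizer of the empirical loss over `W`. -/
  w₀_measurable : Measurable[ℱ 0] w₀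
  w₀_mem : ∀ ω, w₀ ω ∈ W
  w₀_approx : ∀ᵐ ω ∂P, IsApproxMinimizer
    (empiricalLoss N f (fun s => x₁ s ω) (fun s => f (x₁ s ω) wstar + η₁ s ω)) W ε (w₀ ω)
  /-- Phase II: optimistic queries, each based on the past, and fresh sub-Gaussian noise. -/
  x_measurable : ∀ t < N * T, Measurable[ℱ t] (x (t + 1))
  x_optimistic : ∀ t < N * T, ∀ ω,
    IsOptimistic f X W
      ((trajectoryAt f wstar w₀ x η ω).ball f lam β
        (((trajectoryAt f wstar w₀ x η ω).clientSets f lam thr N t).cur (clientAt N (t + 1))))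
      (x (t + 1) ω)
  η_measurable : ∀ t < N * T, Measurable[ℱ (t + 1)] (η (t + 1))
  η_mean : ∀ t < N * T, ∫ ω, η (t + 1) ω ∂P = 0
  η_subgaussian : ∀ t < N * T, HasSubgaussianMGF (η (t + 1)) (σ ^ 2) P
  η_indep : ∀ t < N * T, Indep (MeasurableSpace.comap (η (t + 1)) inferInstance) (ℱ t) P

/-! ### Parameter choices -/

/-- The logarithmic factor `ι = log (3 N T d (1 + Cg) / δ)`. -/
def logFactor (N T d : ℕ) (Cg δ : ℝ) : ℝ :=
  Real.log (3 * N * T * d * (1 + Cg) / δ)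

/-- `C (d σ² + d F² / μ + d³ F⁴ / μ²) ι ^ k`. -/
def radius (C : ℝ) (k d : ℕ) (σ F μ ι : ℝ) : ℝ :=
  C * (d * σ ^ 2 + d * F ^ 2 / μ + d ^ 3 * F ^ 4 / μ ^ 2) * ι ^ k

/-- `T₀ = √(N T)`, rounded up. -/
def phaseOneLength (N T : ℕ) : ℕ := ⌈Real.sqrt (N * T)⌉₊

end FedGOUCB

end

/-!
Let `e = ŵ - w⋆` be the error of a client with data `D`. The normal equations, tested against `e`,
read
`‖e‖²_Σ = ∑_{s ∈ D} ⟨∇_s, e⟩ (r_s + η_s) + lam ⟨w₀ - w⋆, e⟩`,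
where `r_s` is the first order Taylor remainder of `f_{x_s}` between `w₀` and `w⋆`. Young's
inequality absorbs `‖e‖²_Σ / 2` on the left and leaves three terms
(`Trajectory.sqNorm_estimate_le`): `∑ r_s² ≲ N T Ch² ‖w₀ - w⋆‖⁴`, a noise term, and
`lam ‖w₀ - w⋆‖²`. As `T₀² ≥ N T`, the first and the third are controlled by `T₀ ‖w₀ - w⋆‖²`.

*Phase I.* The excess loss of one competitor `w` has an exponential moment in which the term
`(f_x(w) - f_x(w⋆))²` absorbs the noise and still leaves a fixed part of its own mean
(`lintegral_exp_excess_le`). With a union bound over a grid net of `W` this gives the fast rate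
`T₀ L(w₀) ≲ d F² ι` (`IsRun.measure_not_expectedLoss_le`). The growth condition and the lower bound
on `T₀` turn it into `T₀ ‖w₀ - w⋆‖² ≲ d F² ι / μ` (`mul_sq_le_of_min_le`). Since the growth
condition is global, self-concordance plays no role here.

*Noise in Phase II.* For a fixed direction `θ` and a fixed index set the usual exponential
supermartingale has mean at most one (`lintegral_exp_martingale_le_one`). Instead of mixing over
Gaussian directions, a union bound is taken over a grid net of a large ball, outside of which the
regularization `lam ‖θ‖²` dominates (`sum_inner_mul_le_of_net`). The mesh and the size of the ball
are polynomial in `exp ι`, so the net costs a multiple of `d ι`.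

*Communication.* The index sets are random, but whatever the triggers do, each of them is determined
by the client, the current time and the time of the last synchronization
(`Trajectory.exists_clientSets_cur_eq`). A union bound over this polynomially large deterministic
family replaces a stopping time argument.
-/

namespace FedGOUCB

/-! ### Ridge regression as a deterministic estimate -/

section Ridge

variable {dx dw : ℕ} (h : Trajectory dx dw) (f : Vec dx → Vec dw → ℝ) (lam : ℝ) (D : Finset ℕ)

lemma Trajectory.sigma_mulVec (v : Vec dw) :
    (h.sigma f lam D).mulVec v.ofLp
      = (lam • v + ∑ s ∈ D, inner ℝ (h.grad f s) v • h.grad f s).ofLp := by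
  ext j
  simp only [Trajectory.sigma, Trajectory.gram, Matrix.add_mulVec, Matrix.smul_mulVec,
    Matrix.one_mulVec, Matrix.sum_mulVec, Matrix.vecMulVec_mulVec, WithLp.ofLp_add,
    WithLp.ofLp_smul, WithLp.ofLp_sum, Pi.add_apply, Finset.sum_apply, Pi.smul_apply, smul_eq_mul]
  congr 1
  refine Finset.sum_congr rfl fun s _ => ?_
  rw [EuclideanSpace.inner_eq_star_dotProduct]
  simp [dotProduct_comm, mul_comm]

lemma Trajectory.sqNorm_sigma (v : Vec dw) :
    sqNorm (h.sigma f lam D) v = lam * ‖v‖ ^ 2 + ∑ s ∈ D, inner ℝ (h.grad f s) v ^ 2 := by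
  have key : ∀ u : Vec dw, v.ofLp ⬝ᵥ u.ofLp = inner ℝ u v := fun u => by
    rw [EuclideanSpace.inner_eq_star_dotProduct]; simp
  rw [sqNorm, h.sigma_mulVec f lam D v, key, inner_add_left, real_inner_smul_left,
    real_inner_self_eq_norm_sq, sum_inner]
  congr 1
  refine Finset.sum_congr rfl fun s _ => ?_
  rw [real_inner_smul_left, sq]

variable {lam}

lemma Trajectory.isUnit_sigma (hlam : 0 < lam) : IsUnit (h.sigma f lam D) := by
  rw [← Matrix.mulVec_injective_iff_isUnit]
  refine (injective_iff_map_eq_zero (Matrix.mulVecLin (h.sigma f lam D))).2 fun v hv => ?_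
  have h1 : sqNorm (h.sigma f lam D) (WithLp.toLp 2 v) = 0 := by
    simp only [Matrix.mulVecLin_apply] at hv
    simp [sqNorm, hv]
  rw [h.sqNorm_sigma f lam D] at h1
  have h2 : 0 ≤ ∑ s ∈ D, inner ℝ (h.grad f s) (WithLp.toLp 2 v) ^ 2 :=
    Finset.sum_nonneg fun _ _ => sq_nonneg _
  have h3 : ‖WithLp.toLp 2 v‖ ^ 2 = 0 := by
    have := sq_nonneg ‖WithLp.toLp 2 v‖
    nlinarith
  have h4 : WithLp.toLp 2 v = (0 : Vec dw) := by simpa using h3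
  simpa using congrArg WithLp.ofLp h4

/-- The normal equations of the ridge estimate, tested against its error. -/
lemma Trajectory.sqNorm_estimate_sub (hlam : 0 < lam) (wstar : Vec dw) :
    let e := h.estimate f lam D - wstar
    sqNorm (h.sigma f lam D) e
      = ∑ s ∈ D, inner ℝ (h.grad f s) e *
          (h.y s - f (h.x s) h.w₀ - inner ℝ (h.grad f s) (wstar - h.w₀))
        + lam * inner ℝ (h.w₀ - wstar) e := by
  intro e
  have hdet : IsUnit (h.sigma f lam D).det :=
    (Matrix.isUnit_iff_isUnit_det _).1 (h.isUnit_sigma f D hlam)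
  have h1 : (h.sigma f lam D).mulVec (h.estimate f lam D).ofLp
      = (h.bvec f D + lam • h.w₀).ofLp := by
    simp only [Trajectory.estimate, Matrix.mulVec_add, Matrix.mulVec_smul, Matrix.mulVec_mulVec,
      Matrix.mul_nonsing_inv _ hdet, Matrix.one_mulVec, WithLp.ofLp_add, WithLp.ofLp_smul]
  have h2 : (h.sigma f lam D).mulVec e.ofLp
      = (h.bvec f D + lam • h.w₀
        - (lam • wstar + ∑ s ∈ D, inner ℝ (h.grad f s) wstar • h.grad f s)).ofLp := by
    rw [WithLp.ofLp_sub, Matrix.mulVec_sub, h1, h.sigma_mulVec f lam D wstar, WithLp.ofLp_sub]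
  have key : ∀ u : Vec dw, e.ofLp ⬝ᵥ u.ofLp = inner ℝ u e := fun u => by
    rw [EuclideanSpace.inner_eq_star_dotProduct]; simp
  rw [sqNorm, h2, key]
  simp only [Trajectory.bvec, inner_sub_left, inner_add_left, sum_inner, real_inner_smul_left,
    inner_sub_right, mul_sub, sub_mul, add_mul, Finset.sum_sub_distrib, Finset.sum_add_distrib,
    mul_comm]
  ring

/-- The error of the ridge estimate is controlled by the linearization residuals `r`, the noise,
tested against all directions at once, and the bias of the regularization center. -/
lemma Trajectory.sqNorm_estimate_le (hlam : 0 < lam) (wstar : Vec dw) {r η : ℕ → ℝ} {B R : ℝ}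
    (hy : ∀ s ∈ D, h.y s - f (h.x s) h.w₀ - inner ℝ (h.grad f s) (wstar - h.w₀) = r s + η s)
    (hr : ∑ s ∈ D, r s ^ 2 ≤ R)
    (hη : ∀ θ : Vec dw, ∑ s ∈ D, inner ℝ (h.grad f s) θ * η s
      ≤ sqNorm (h.sigma f lam D) θ / 4 + B) :
    sqNorm (h.sigma f lam D) (h.estimate f lam D - wstar)
      ≤ 2 * (R + B + lam * ‖h.w₀ - wstar‖ ^ 2) := by
  set e := h.estimate f lam D - wstar with he
  have h1 := h.sqNorm_estimate_sub f D hlam wstar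
  simp only [← he] at h1
  rw [Finset.sum_congr rfl fun s hs => by rw [hy s hs, mul_add], Finset.sum_add_distrib] at h1
  have h2 := hη e
  have h3 : ∑ s ∈ D, inner ℝ (h.grad f s) e * r s
      ≤ (∑ s ∈ D, inner ℝ (h.grad f s) e ^ 2) / 4 + ∑ s ∈ D, r s ^ 2 := by
    rw [Finset.sum_div, ← Finset.sum_add_distrib]
    refine Finset.sum_le_sum fun s _ => ?_
    nlinarith [sq_nonneg (inner ℝ (h.grad f s) e / 2 - r s)]
  have h4 : inner ℝ (h.w₀ - wstar) e ≤ ‖e‖ ^ 2 / 4 + ‖h.w₀ - wstar‖ ^ 2 := by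
    have := real_inner_le_norm (h.w₀ - wstar) e
    nlinarith [sq_nonneg (‖e‖ / 2 - ‖h.w₀ - wstar‖)]
  have h5 := mul_le_mul_of_nonneg_left h4 hlam.le
  have h6 := h.sqNorm_sigma f lam D e
  linarith

end Ridge

/-! ### The index sets of the clients -/

/-- The data of client `i` at time `t` when the last synchronization took place at time `τ`:
everything up to `τ`, and afterwards only the client's own time steps. -/
def sharedSet (N : ℕ) [NeZero N] (τ t : ℕ) (i : Fin N) : Finset ℕ :=
  (Finset.Icc 1 t).filter fun s => s ≤ τ ∨ clientAt N s = i

lemma localUpdate_cur_eq_sharedSet {N : ℕ} [NeZero N] {τ t : ℕ} {S : ClientSets N}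
    (hS : ∀ i, S.cur i = sharedSet N τ t i) (hτ : τ ≤ t) (i : Fin N) :
    (S.localUpdate (t + 1)).cur i = sharedSet N τ (t + 1) i := by
  ext s
  by_cases hi : i = clientAt N (t + 1)
  · subst hi
    simp only [ClientSets.localUpdate, Function.update_self, hS, sharedSet, Finset.mem_insert,
      Finset.mem_filter, Finset.mem_Icc]
    constructor
    · rintro (rfl | h)
      · exact ⟨by omega, Or.inr rfl⟩
      · exact ⟨by omega, h.2⟩
    · rintro ⟨h1, h2⟩
      by_cases h : s = t + 1
      · exact Or.inl h
      · exact Or.inr ⟨by omega, h2⟩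
  · simp only [ClientSets.localUpdate, Function.update_of_ne hi, hS, sharedSet,
      Finset.mem_filter, Finset.mem_Icc]
    constructor
    · rintro ⟨h1, h2⟩
      exact ⟨by omega, h2⟩
    · rintro ⟨h1, h2⟩
      refine ⟨⟨h1.1, ?_⟩, h2⟩
      by_contra hlt
      have hs : s = t + 1 := by omega
      subst hs
      rcases h2 with h2 | h2
      · omega
      · exact hi h2.symm

/-- Whatever the triggers do, the index sets stay in a deterministic family of polynomial size, so
that a union bound over this family replaces any stopping time argument. -/
lemma Trajectory.exists_clientSets_cur_eq {dx dw : ℕ} (h : Trajectory dx dw)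
    (f : Vec dx → Vec dw → ℝ) (lam thr : ℝ) (N : ℕ) [NeZero N] (t : ℕ) :
    ∃ τ ≤ t, ∀ i, (h.clientSets f lam thr N t).cur i = sharedSet N τ t i := by
  induction t with
  | zero => exact ⟨0, le_rfl, fun i => by simp [Trajectory.clientSets, sharedSet]⟩
  | succ t ih =>
    obtain ⟨τ, hτ, ih⟩ := ih
    have hl := localUpdate_cur_eq_sharedSet ih hτ
    simp only [Trajectory.clientSets]
    split_ifs
    · refine ⟨t + 1, le_rfl, fun i => ?_⟩
      ext s
      simp only [ClientSets.synchronize, Finset.mem_biUnion, Finset.mem_univ, true_and, hl,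
        sharedSet, Finset.mem_filter, Finset.mem_Icc]
      constructor
      · rintro ⟨j, h1, -⟩
        exact ⟨h1, Or.inl h1.2⟩
      · rintro ⟨h1, -⟩
        exact ⟨clientAt N s, h1, Or.inr rfl⟩
    · exact ⟨τ, hτ.trans (Nat.le_succ t), hl⟩

lemma Trajectory.exists_activeSet_eq {dx dw : ℕ} (h : Trajectory dx dw)
    (f : Vec dx → Vec dw → ℝ) (lam thr : ℝ) (N : ℕ) [NeZero N] {t : ℕ} (ht : 1 ≤ t) :
    ∃ τ ≤ t, h.activeSet f lam thr N t = sharedSet N τ t (clientAt N t) := by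
  obtain ⟨t, rfl⟩ : ∃ u, t = u + 1 := ⟨t - 1, by omega⟩
  obtain ⟨τ, hτ, hcur⟩ := h.exists_clientSets_cur_eq f lam thr N t
  exact ⟨τ, hτ.trans (Nat.le_succ t), localUpdate_cur_eq_sharedSet hcur hτ _⟩

/-! ### Regularity of the model on the parameter set -/

section Regularity

variable {dx dw : ℕ} {X : Set (Vec dx)} {W : Set (Vec dw)} {f : Vec dx → Vec dw → ℝ}
  {F Cg Ch : ℝ}

lemma BoundedSmooth.abs_sub_le (hf : BoundedSmooth X W f F Cg Ch) (hW : Convex ℝ W) {x : Vec dx}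
    (hx : x ∈ X) {w w' : Vec dw} (hw : w ∈ W) (hw' : w' ∈ W) :
    |f x w - f x w'| ≤ Cg * ‖w - w'‖ := by
  refine hW.norm_image_sub_le_of_norm_fderiv_le (𝕜 := ℝ) (f := f x)
    (fun u hu => hf.differentiableAt x hx u hu) (fun u hu => ?_) hw' hw
  have := hf.norm_gradient_le x hx u hu
  rwa [gradient, LinearIsometryEquiv.norm_map] at this

/-- The first order Taylor remainder on the convex set `W`. -/
lemma BoundedSmooth.abs_remainder_le (hf : BoundedSmooth X W f F Cg Ch) (hW : Convex ℝ W)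
    {x : Vec dx} (hx : x ∈ X) {w w₀ : Vec dw} (hw : w ∈ W) (hw₀ : w₀ ∈ W) (hCh : 0 ≤ Ch) :
    |f x w - f x w₀ - inner ℝ (gradient (f x) w₀) (w - w₀)| ≤ Ch * ‖w - w₀‖ ^ 2 := by
  have hin : inner ℝ (gradient (f x) w₀) (w - w₀) = fderiv ℝ (f x) w₀ (w - w₀) := by
    rw [gradient, InnerProductSpace.toDual_symm_apply]
  rw [hin]
  have hseg : segment ℝ w₀ w ⊆ W := hW.segment_subset hw₀ hw
  have := (convex_segment w₀ w).norm_image_sub_le_of_norm_fderiv_le' (𝕜 := ℝ) (f := f x)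
    (φ := fderiv ℝ (f x) w₀) (C := Ch * ‖w - w₀‖)
    (fun u hu => hf.differentiableAt x hx u (hseg hu)) (fun u hu => ?_)
    (left_mem_segment ℝ w₀ w) (right_mem_segment ℝ w₀ w)
  · rw [sq, ← mul_assoc]; exact this
  · refine (hW.norm_image_sub_le_of_norm_fderiv_le (𝕜 := ℝ) (f := fderiv ℝ (f x))
      (fun u hu => hf.differentiableAt_fderiv x hx u hu)
      (fun u hu => hf.norm_hessian_le x hx u hu) hw₀ (hseg hu)).trans ?_
    gcongr
    obtain ⟨a, b, ha, hb, hab, rfl⟩ := hu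
    have : a • w₀ + b • w - w₀ = b • (w - w₀) := by
      rw [show a = 1 - b by linarith]; module
    rw [this, norm_smul, Real.norm_of_nonneg hb]
    exact mul_le_of_le_one_left (norm_nonneg _) (by linarith)

end Regularity

/-! ### Finite nets -/

/-- A set of points with coordinates in `[-R, R]` has a net of mesh `√d h`, made of points of the
set itself: one point from each cell of a grid with `m` cells of length `h` per coordinate. -/
lemma exists_grid_net {d m : ℕ} {R h : ℝ} (hh : 0 < h) (hm : 2 * R / h < m) {A : Set (Vec d)}
    (hA : A.Nonempty) (hR : ∀ v ∈ A, ∀ j, |v j| ≤ R) :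
    ∃ p : (Fin d → Fin m) → Vec d, (∀ c, p c ∈ A) ∧
      ∀ v ∈ A, ∃ c, ‖v - p c‖ ≤ Real.sqrt d * h := by
  classical
  have hcell : ∀ v ∈ A, ∀ j, ⌊(v j + R) / h⌋₊ < m := fun v hv j => by
    have := abs_le.1 (hR v hv j)
    refine (Nat.floor_lt (by apply div_nonneg <;> linarith)).2 (lt_of_le_of_lt ?_ hm)
    gcongr
    linarith
  let cell : A → Fin d → Fin m := fun v j => ⟨⌊((v : Vec d) j + R) / h⌋₊, hcell v v.2 j⟩
  have : Nonempty A := hA.to_subtype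
  refine ⟨fun c => (Function.invFun cell c : A), fun c => (Function.invFun cell c).2,
    fun v hv => ⟨cell ⟨v, hv⟩, ?_⟩⟩
  set u : A := Function.invFun cell (cell ⟨v, hv⟩)
  have hu : cell u = cell ⟨v, hv⟩ := Function.invFun_eq ⟨_, rfl⟩
  have hj : ∀ j, ((v - u : Vec d) j) ^ 2 ≤ h ^ 2 := fun j => by
    have h1 : ⌊((u : Vec d) j + R) / h⌋₊ = ⌊(v j + R) / h⌋₊ := by
      simpa [cell] using congrFun hu j
    have hv0 := abs_le.1 (hR v hv j)
    have hu0 := abs_le.1 (hR u u.2 j)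
    have hv1 : 0 ≤ (v j + R) / h := by apply div_nonneg <;> linarith
    have hu1 : 0 ≤ ((u : Vec d) j + R) / h := by apply div_nonneg <;> linarith
    have a1 := Nat.floor_le hv1
    have a2 := Nat.lt_floor_add_one ((v j + R) / h)
    have b1 := Nat.floor_le hu1
    have b2 := Nat.lt_floor_add_one (((u : Vec d) j + R) / h)
    rw [h1] at b1 b2
    rw [le_div_iff₀ hh] at a1 b1
    rw [div_lt_iff₀ hh] at a2 b2
    rw [PiLp.sub_apply]
    apply sq_le_sq'
    · linarith
    · linarith
  rw [EuclideanSpace.norm_eq]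
  calc Real.sqrt (∑ j, ‖(v - u : Vec d) j‖ ^ 2) ≤ Real.sqrt (∑ _j : Fin d, h ^ 2) := by
        apply Real.sqrt_le_sqrt
        refine Finset.sum_le_sum fun j _ => ?_
        rw [Real.norm_eq_abs, sq_abs]
        exact hj j
    _ = Real.sqrt d * h := by
        rw [Finset.sum_const, Finset.card_univ, Fintype.card_fin, nsmul_eq_mul,
          Real.sqrt_mul (Nat.cast_nonneg d), Real.sqrt_sq hh.le]

/-! ### Exponential moments and tail bounds -/

section Tails

variable {Ω : Type*} {mΩ : MeasurableSpace Ω} {P : Measure Ω}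

lemma measure_lt_le_of_lintegral_exp_le_one {Y : Ω → ℝ} (hY : AEMeasurable Y P)
    (h : ∫⁻ ω, ENNReal.ofReal (Real.exp (Y ω)) ∂P ≤ 1) (K : ℝ) :
    P {ω | K < Y ω} ≤ ENNReal.ofReal (Real.exp (-K)) := by
  have h1 := mul_meas_ge_le_lintegral₀
    (ENNReal.measurable_ofReal.comp_aemeasurable (Real.measurable_exp.comp_aemeasurable hY))
    (ENNReal.ofReal (Real.exp K)) (μ := P)
  have h2 : P {ω | K < Y ω}
      ≤ P {ω | ENNReal.ofReal (Real.exp K) ≤ ENNReal.ofReal (Real.exp (Y ω))} :=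
    measure_mono fun ω hω => ENNReal.ofReal_le_ofReal (Real.exp_le_exp.2 (le_of_lt hω))
  have h3 : ENNReal.ofReal (Real.exp (-K)) = (ENNReal.ofReal (Real.exp K))⁻¹ := by
    rw [Real.exp_neg, ENNReal.ofReal_inv_of_pos (Real.exp_pos K)]
  rw [h3, ← one_div, ENNReal.le_div_iff_mul_le (Or.inl (by simp [Real.exp_pos]))
    (Or.inl ENNReal.ofReal_ne_top), mul_comm]
  exact (mul_le_mul_right h2 _).trans (h1.trans h)

lemma hasSubgaussianMGF_mono {X : Ω → ℝ} {c c' : ℝ≥0} (h : HasSubgaussianMGF X c P)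
    (hc : c ≤ c') : HasSubgaussianMGF X c' P :=
  ⟨h.integrable_exp_mul, fun t => (h.mgf_le t).trans (Real.exp_le_exp.2 (by
    have : (c : ℝ) ≤ c' := hc
    gcongr))⟩

lemma lintegral_exp_mul_le {X : Ω → ℝ} {c : ℝ≥0} (h : HasSubgaussianMGF X c P) (a : ℝ) :
    ∫⁻ ω, ENNReal.ofReal (Real.exp (a * X ω)) ∂P
      ≤ ENNReal.ofReal (Real.exp (c * a ^ 2 / 2)) := by
  rw [← ofReal_integral_eq_lintegral_ofReal (h.integrable_exp_mul a)
    (Filter.Eventually.of_forall fun ω => (Real.exp_pos _).le)]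
  exact ENNReal.ofReal_le_ofReal (h.mgf_le a)

lemma measure_lt_abs_le [IsProbabilityMeasure P] {X : Ω → ℝ} {c : ℝ≥0} {b u : ℝ}
    (h : HasSubgaussianMGF X c P) (hb : 0 < b) (hc : (c : ℝ) ≤ b ^ 2) (hu : 0 ≤ u) :
    P {ω | u * b < |X ω|} ≤ ENNReal.ofReal (2 * Real.exp (-u ^ 2 / 2)) := by
  have h' : HasSubgaussianMGF X ⟨b ^ 2, sq_nonneg b⟩ P := hasSubgaussianMGF_mono h hc
  have key : ∀ Z : Ω → ℝ, HasSubgaussianMGF Z ⟨b ^ 2, sq_nonneg b⟩ P →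
      P {ω | u * b ≤ Z ω} ≤ ENNReal.ofReal (Real.exp (-u ^ 2 / 2)) := fun Z hZ => by
    have := hZ.measure_ge_le (mul_nonneg hu hb.le)
    rw [← ENNReal.ofReal_toReal (measure_ne_top P _)]
    refine ENNReal.ofReal_le_ofReal (this.trans (le_of_eq ?_))
    congr 1
    change -(u * b) ^ 2 / (2 * b ^ 2) = _
    field_simp
  calc P {ω | u * b < |X ω|} ≤ P ({ω | u * b ≤ X ω} ∪ {ω | u * b ≤ (-X) ω}) :=
        measure_mono fun ω hω => (lt_abs.1 hω).imp (fun h => h.le)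
          fun h => show u * b ≤ -X ω from h.le
    _ ≤ _ := measure_union_le _ _
    _ ≤ _ := add_le_add (key X h') (key (-X) h'.neg)
    _ = _ := by rw [← ENNReal.ofReal_add (Real.exp_pos _).le (Real.exp_pos _).le, two_mul]

lemma lintegral_comp_prodMk_eq {α β : Type*} [MeasurableSpace α] [MeasurableSpace β]
    [IsProbabilityMeasure P] {U : Ω → α} {V : Ω → β} (hU : Measurable U) (hV : Measurable V)
    (hUV : IndepFun U V P) {g : α × β → ℝ≥0∞} (hg : Measurable g) :
    ∫⁻ ω, g (U ω, V ω) ∂P = ∫⁻ ω, ∫⁻ ω', g (U ω, V ω') ∂P ∂P := by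
  have := Measure.isProbabilityMeasure_map hU.aemeasurable (μ := P)
  have := Measure.isProbabilityMeasure_map hV.aemeasurable (μ := P)
  have hmap := (indepFun_iff_map_prod_eq_prod_map_map hU.aemeasurable hV.aemeasurable).1 hUV
  rw [← lintegral_map hg (hU.prodMk hV), hmap, lintegral_prod _ hg.aemeasurable,
    lintegral_map hg.lintegral_prod_right' hU]
  refine lintegral_congr fun ω => ?_
  exact lintegral_map (f := fun y => g (U ω, y)) (hg.comp measurable_prodMk_left) hV

end Tails

/-! ### The exponential supermartingale of a sub-Gaussian martingale transform -/

/-- Restricting the sum to a deterministic index set `D` keeps the exponential moment bounded. -/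
lemma lintegral_exp_martingale_le_one {Ω : Type*} {mΩ : MeasurableSpace Ω} {P : Measure Ω}
    [IsProbabilityMeasure P] {ℱ : Filtration ℕ mΩ} {a ξ : ℕ → Ω → ℝ} {n : ℕ}
    (ha : ∀ t < n, Measurable[ℱ t] (a (t + 1))) (hξ : ∀ t < n, Measurable[ℱ (t + 1)] (ξ (t + 1)))
    (hsub : ∀ t < n, HasSubgaussianMGF (ξ (t + 1)) 1 P)
    (hind : ∀ t < n, Indep (MeasurableSpace.comap (ξ (t + 1)) inferInstance) (ℱ t) P)
    {D : Finset ℕ} (hD : D ⊆ Finset.Icc 1 n) :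
    Measurable[ℱ n] (fun ω => ∑ s ∈ D, (a s ω * ξ s ω - a s ω ^ 2 / 2)) ∧
    ∫⁻ ω, ENNReal.ofReal (Real.exp (∑ s ∈ D, (a s ω * ξ s ω - a s ω ^ 2 / 2))) ∂P ≤ 1 := by
  induction n generalizing D with
  | zero =>
    have : D = ∅ := by simpa using hD
    subst this
    simp
  | succ n ih =>
    have ih' := fun {D : Finset ℕ} (hD : D ⊆ Finset.Icc 1 n) =>
      ih (fun t ht => ha t (ht.trans n.lt_succ_self)) (fun t ht => hξ t (ht.trans n.lt_succ_self))
        (fun t ht => hsub t (ht.trans n.lt_succ_self))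
        (fun t ht => hind t (ht.trans n.lt_succ_self)) hD
    have hmono : ℱ n ≤ ℱ (n + 1) := ℱ.mono n.le_succ
    by_cases hn : n + 1 ∈ D
    · obtain ⟨E, hE, rfl⟩ : ∃ E, n + 1 ∉ E ∧ insert (n + 1) E = D :=
        ⟨D.erase (n + 1), Finset.notMem_erase _ _, Finset.insert_erase hn⟩
      have hEn : E ⊆ Finset.Icc 1 n := fun s hs => by
        have h1 := Finset.mem_Icc.1 (hD (Finset.mem_insert_of_mem hs))
        have h2 : s ≠ n + 1 := fun h => hE (h ▸ hs)
        exact Finset.mem_Icc.2 ⟨h1.1, by omega⟩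
      obtain ⟨hmeas, hint⟩ := ih' hEn
      have han := ha n n.lt_succ_self
      have hξn := hξ n n.lt_succ_self
      simp only [Finset.sum_insert hE]
      constructor
      · have h1 : Measurable[ℱ (n + 1)] (a (n + 1)) := han.mono hmono le_rfl
        exact ((h1.mul hξn).sub ((h1.pow_const 2).div_const 2)).add (hmeas.mono hmono le_rfl)
      set S : Ω → ℝ := fun ω => ∑ s ∈ E, (a s ω * ξ s ω - a s ω ^ 2 / 2)
      have hU : Measurable[ℱ n] (fun ω => (a (n + 1) ω, S ω)) := han.prodMk hmeas
      have hUV : IndepFun (fun ω => (a (n + 1) ω, S ω)) (ξ (n + 1)) P := by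
        rw [IndepFun_iff_Indep]
        exact (indep_of_indep_of_le_right (hind n n.lt_succ_self) hU.comap_le).symm
      have hg : Measurable fun z : (ℝ × ℝ) × ℝ =>
          ENNReal.ofReal (Real.exp (z.1.1 * z.2 - z.1.1 ^ 2 / 2 + z.1.2)) := by fun_prop
      rw [lintegral_comp_prodMk_eq (hU.mono (ℱ.le n) le_rfl) (hξn.mono (ℱ.le _) le_rfl) hUV hg]
      refine (lintegral_mono fun ω => ?_).trans hint
      have hrw : ∀ ω', ENNReal.ofReal (Real.exp (a (n + 1) ω * ξ (n + 1) ω'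
          - a (n + 1) ω ^ 2 / 2 + S ω))
          = ENNReal.ofReal (Real.exp (S ω - a (n + 1) ω ^ 2 / 2))
            * ENNReal.ofReal (Real.exp (a (n + 1) ω * ξ (n + 1) ω')) := fun ω' => by
        rw [← ENNReal.ofReal_mul (Real.exp_pos _).le, ← Real.exp_add]
        congr 2
        ring
      simp only [hrw]
      rw [lintegral_const_mul' _ _ ENNReal.ofReal_ne_top]
      refine (mul_le_mul_right (lintegral_exp_mul_le (hsub n n.lt_succ_self) _) _).trans ?_
      rw [← ENNReal.ofReal_mul (Real.exp_pos _).le, ← Real.exp_add]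
      refine ENNReal.ofReal_le_ofReal (Real.exp_le_exp.2 (le_of_eq ?_))
      simp only [NNReal.coe_one]
      ring
    · have hDn : D ⊆ Finset.Icc 1 n := fun s hs => by
        have h1 := Finset.mem_Icc.1 (hD hs)
        have h2 : s ≠ n + 1 := fun h => hn (h ▸ hs)
        exact Finset.mem_Icc.2 ⟨h1.1, by omega⟩
      exact ⟨(ih' hDn).1.mono hmono le_rfl, (ih' hDn).2⟩

/-! ### Exponential moments of the excess loss -/

/-- The offset of the squared loss: for noise with variance proxy `b²` the quadratic term absorbs
the noise and still leaves a fixed fraction of the mean of `G²`, which is what gives a fast rate. -/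
lemma lintegral_exp_excess_le {Ω : Type*} {mΩ : MeasurableSpace Ω} {P : Measure Ω}
    [IsProbabilityMeasure P] {G η : Ω → ℝ} {b : ℝ} (hb : 0 < b) (hG : Measurable G)
    (hη : Measurable η) (hind : IndepFun G η P) (hGb : ∀ᵐ ω ∂P, |G ω| ≤ 2 * b)
    {c : ℝ≥0} (hsub : HasSubgaussianMGF η c P) (hc : (c : ℝ) ≤ b ^ 2) :
    ∫⁻ ω, ENNReal.ofReal (Real.exp (-(G ω ^ 2 - 2 * η ω * G ω) / (4 * b ^ 2))) ∂P
      ≤ ENNReal.ofReal (Real.exp (-(∫ ω, G ω ^ 2 ∂P) / (16 * b ^ 2))) := by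
  have hg : Measurable fun z : ℝ × ℝ =>
      ENNReal.ofReal (Real.exp (-(z.1 ^ 2 - 2 * z.2 * z.1) / (4 * b ^ 2))) := by fun_prop
  rw [lintegral_comp_prodMk_eq hG hη hind hg]
  have hint : Integrable (fun ω => G ω ^ 2) P := by
    refine Integrable.of_bound (hG.pow_const 2).aestronglyMeasurable ((2 * b) ^ 2) ?_
    filter_upwards [hGb] with ω hω
    rw [Real.norm_of_nonneg (sq_nonneg _)]
    exact sq_le_sq.2 (by rwa [abs_of_pos (by positivity : (0 : ℝ) < 2 * b)])
  have hpt : ∀ᵐ ω ∂P, ∫⁻ ω', ENNReal.ofReal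
      (Real.exp (-(G ω ^ 2 - 2 * η ω' * G ω) / (4 * b ^ 2))) ∂P
      ≤ ENNReal.ofReal (1 - G ω ^ 2 / (16 * b ^ 2)) := by
    filter_upwards [hGb] with ω hω
    have hrw : ∀ ω', ENNReal.ofReal (Real.exp (-(G ω ^ 2 - 2 * η ω' * G ω) / (4 * b ^ 2)))
        = ENNReal.ofReal (Real.exp (-(G ω ^ 2) / (4 * b ^ 2)))
          * ENNReal.ofReal (Real.exp (G ω / (2 * b ^ 2) * η ω')) := fun ω' => by
      rw [← ENNReal.ofReal_mul (Real.exp_pos _).le, ← Real.exp_add]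
      congr 2
      field_simp
      ring
    simp only [hrw]
    rw [lintegral_const_mul' _ _ ENNReal.ofReal_ne_top]
    refine (mul_le_mul_right (lintegral_exp_mul_le hsub _) _).trans ?_
    rw [← ENNReal.ofReal_mul (Real.exp_pos _).le, ← Real.exp_add]
    refine ENNReal.ofReal_le_ofReal ?_
    set u := G ω ^ 2 / (8 * b ^ 2) with hu
    have hu0 : 0 ≤ u := by positivity
    have hu1 : u ≤ 1 := by
      rw [hu, div_le_one (by positivity)]
      nlinarith [abs_le.1 hω, sq_abs (G ω), sq_nonneg b, abs_nonneg (G ω)]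
    have h1 : -(G ω ^ 2) / (4 * b ^ 2) + c * (G ω / (2 * b ^ 2)) ^ 2 / 2 ≤ -u := by
      have h2 : (c : ℝ) * (G ω / (2 * b ^ 2)) ^ 2 / 2 ≤ b ^ 2 * (G ω / (2 * b ^ 2)) ^ 2 / 2 := by
        gcongr
      have h3 : b ^ 2 * (G ω / (2 * b ^ 2)) ^ 2 / 2 = u := by rw [hu]; field_simp; norm_num
      have h4 : -(G ω ^ 2) / (4 * b ^ 2) = -2 * u := by rw [hu]; field_simp; ring
      linarith
    have h5 : Real.exp (-u) ≤ 1 - u / 2 := by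
      have h6 : u + 1 ≤ Real.exp u := Real.add_one_le_exp u
      rw [Real.exp_neg]
      refine inv_le_of_inv_le₀ (by linarith) (le_trans ?_ h6)
      rw [inv_le_iff_one_le_mul₀ (by linarith)]
      nlinarith
    have h7 : G ω ^ 2 / (16 * b ^ 2) = u / 2 := by rw [hu]; field_simp; ring
    rw [h7]
    exact (Real.exp_le_exp.2 h1).trans h5
  refine (lintegral_mono_ae hpt).trans ?_
  have hnn : 0 ≤ᵐ[P] fun ω => 1 - G ω ^ 2 / (16 * b ^ 2) := by
    filter_upwards [hGb] with ω hω
    have : G ω ^ 2 / (16 * b ^ 2) ≤ 1 := by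
      rw [div_le_one (by positivity)]
      nlinarith [abs_le.1 hω, sq_abs (G ω), sq_nonneg b, abs_nonneg (G ω)]
    simpa using this
  have hint' : Integrable (fun ω => 1 - G ω ^ 2 / (16 * b ^ 2)) P :=
    (integrable_const _).sub (hint.div_const _)
  rw [← ofReal_integral_eq_lintegral_ofReal hint' hnn]
  refine ENNReal.ofReal_le_ofReal ?_
  rw [integral_sub (integrable_const _) (hint.div_const _), integral_div]
  simp only [integral_const, probReal_univ, smul_eq_mul, mul_one]
  have := Real.add_one_le_exp (-(∫ ω, G ω ^ 2 ∂P) / (16 * b ^ 2))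
  rw [neg_div] at this ⊢
  linarith

lemma lintegral_prod_comp_le {Ω γ : Type*} {mΩ : MeasurableSpace Ω} [MeasurableSpace γ]
    {P : Measure Ω} {n : ℕ} {Z : Fin n → Ω → γ} (hZ : ∀ s, Measurable (Z s))
    (hind : iIndepFun Z P) {φ : γ → ℝ≥0∞} (hφ : Measurable φ) {A : ℝ≥0∞}
    (hA : ∀ s, ∫⁻ ω, φ (Z s ω) ∂P ≤ A) :
    ∫⁻ ω, ∏ s, φ (Z s ω) ∂P ≤ A ^ n := by
  have h := lintegral_prod_eq_prod_lintegral_of_indepFun Finset.univ (fun s ω => φ (Z s ω))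
    (hind.comp (fun _ => φ) fun _ => hφ) (fun s => hφ.comp (hZ s))
  rw [h]
  exact (Finset.prod_le_prod' fun s _ => hA s).trans (by simp)

/-- A one-sided Bernstein-type bound for the empirical excess loss of one fixed competitor. -/
lemma measure_excess_lt_le {Ω α : Type*} {mΩ : MeasurableSpace Ω} [MeasurableSpace α]
    {P : Measure Ω} [IsProbabilityMeasure P] {n : ℕ} {x : Fin n → Ω → α} {η : Fin n → Ω → ℝ}
    {ν : Measure α} {g : α → ℝ} {b : ℝ} {c : ℝ≥0} (hb : 0 < b)
    (hx : ∀ s, Measurable (x s)) (hη : ∀ s, Measurable (η s)) (hlaw : ∀ s, P.map (x s) = ν)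
    (hsamples : iIndepFun (fun s ω => (x s ω, η s ω)) P) (hnoise : ∀ s, IndepFun (x s) (η s) P)
    (hsub : ∀ s, HasSubgaussianMGF (η s) c P) (hc : (c : ℝ) ≤ b ^ 2)
    (hg : Measurable g) (hgb : ∀ᵐ z ∂ν, |g z| ≤ 2 * b) (K : ℝ) :
    P {ω | ∑ s, (g (x s ω) ^ 2 - 2 * η s ω * g (x s ω)) + 4 * b ^ 2 * K
        < n / 4 * ∫ z, g z ^ 2 ∂ν} ≤ ENNReal.ofReal (Real.exp (-K)) := by
  set L := ∫ z, g z ^ 2 ∂ν with hL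
  have hsingle : ∀ s, ∫⁻ ω, ENNReal.ofReal (Real.exp
      (-(g (x s ω) ^ 2 - 2 * η s ω * g (x s ω)) / (4 * b ^ 2))) ∂P
      ≤ ENNReal.ofReal (Real.exp (-L / (16 * b ^ 2))) := fun s => by
    have h1 : ∫ ω, g (x s ω) ^ 2 ∂P = L := by
      rw [hL, ← hlaw s, integral_map (hx s).aemeasurable (hg.pow_const 2).aestronglyMeasurable]
    rw [← h1]
    refine lintegral_exp_excess_le hb (hg.comp (hx s)) (hη s)
      ((hnoise s).comp hg measurable_id) ?_ (hsub s) hc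
    rw [← hlaw s] at hgb
    exact ae_of_ae_map (hx s).aemeasurable hgb
  have hφ : Measurable fun z : α × ℝ => ENNReal.ofReal (Real.exp
      (-(g z.1 ^ 2 - 2 * z.2 * g z.1) / (4 * b ^ 2))) := by
    have := hg.comp (measurable_fst : Measurable (Prod.fst : α × ℝ → α))
    simp only [Function.comp_def] at this
    fun_prop
  have hY : Measurable fun ω => (n * L / (16 * b ^ 2)
      + ∑ s, -(g (x s ω) ^ 2 - 2 * η s ω * g (x s ω)) / (4 * b ^ 2)) := by
    have := fun s => hg.comp (hx s)
    simp only [Function.comp_def] at this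
    fun_prop
  have hone : ∫⁻ ω, ENNReal.ofReal (Real.exp (n * L / (16 * b ^ 2)
      + ∑ s, -(g (x s ω) ^ 2 - 2 * η s ω * g (x s ω)) / (4 * b ^ 2))) ∂P ≤ 1 := by
    have hsplit : ∀ ω, ENNReal.ofReal (Real.exp (n * L / (16 * b ^ 2)
        + ∑ s, -(g (x s ω) ^ 2 - 2 * η s ω * g (x s ω)) / (4 * b ^ 2)))
        = ENNReal.ofReal (Real.exp (n * L / (16 * b ^ 2)))
          * ∏ s, ENNReal.ofReal (Real.exp
            (-(g (x s ω) ^ 2 - 2 * η s ω * g (x s ω)) / (4 * b ^ 2))) := fun ω => by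
      rw [Real.exp_add, Real.exp_sum, ENNReal.ofReal_mul (Real.exp_pos _).le,
        ENNReal.ofReal_prod_of_nonneg fun _ _ => (Real.exp_pos _).le]
    rw [lintegral_congr hsplit, lintegral_const_mul' _ _ ENNReal.ofReal_ne_top]
    refine (mul_le_mul_right (lintegral_prod_comp_le (fun s => (hx s).prodMk (hη s)) hsamples hφ
      hsingle) _).trans ?_
    rw [← ENNReal.ofReal_pow (Real.exp_pos _).le, ← ENNReal.ofReal_mul (Real.exp_pos _).le,
      ← Real.exp_nat_mul, ← Real.exp_add]
    have : (n : ℝ) * L / (16 * b ^ 2) + n * (-L / (16 * b ^ 2)) = 0 := by ring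
    rw [this]
    simp
  refine (measure_mono fun ω hω => ?_).trans
    (measure_lt_le_of_lintegral_exp_le_one hY.aemeasurable hone K)
  simp only [Set.mem_ofPred_eq] at hω ⊢
  rw [← Finset.sum_div, Finset.sum_neg_distrib]
  have h1 : n * L / (16 * b ^ 2) = (n / 4 * L) / (4 * b ^ 2) := by field_simp; norm_num
  rw [h1, ← add_div, lt_div_iff₀ (by positivity)]
  linarith

/-! ### The empirical risk minimizer of Phase I -/

section PhaseOne

variable {dx dw : ℕ} {X : Set (Vec dx)} {W : Set (Vec dw)} {f : Vec dx → Vec dw → ℝ}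
  {wstar : Vec dw} {F Cg Ch : ℝ}

lemma IsDomainSet.isProbabilityMeasure_uniformLaw (hX : IsDomainSet X) :
    IsProbabilityMeasure (uniformLaw X) := by
  refine cond_isProbabilityMeasure_of_finite hX.volume_ne_zero (ne_of_lt ?_)
  have hbdd : Bornology.IsBounded X := by
    refine (Metric.isBounded_closedBall (x := (0 : Vec dx)) (r := Real.sqrt dx)).subset
      fun v hv => ?_
    rw [mem_closedBall_zero_iff, EuclideanSpace.norm_eq]
    refine Real.sqrt_le_sqrt ((Finset.sum_le_sum (g := fun _ => (1 : ℝ)) fun j _ => ?_).trans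
      (by simp))
    have := hX.subset_cube hv j
    rw [Real.norm_eq_abs, sq_abs]
    nlinarith
  exact hbdd.measure_lt_top

lemma IsDomainSet.ae_mem (hX : IsDomainSet X) : ∀ᵐ z ∂(uniformLaw X), z ∈ X :=
  ae_cond_mem hX.measurableSet

lemma BoundedSmooth.measurable_left (hf : BoundedSmooth X W f F Cg Ch) (w : Vec dw) :
    Measurable fun z => f z w :=
  hf.measurable.comp (measurable_id.prodMk measurable_const)

lemma BoundedSmooth.abs_sub_le_two_mul (hf : BoundedSmooth X W f F Cg Ch) {z : Vec dx}
    (hz : z ∈ X) {w w' : Vec dw} (hw : w ∈ W) (hw' : w' ∈ W) : |f z w - f z w'| ≤ 2 * F := by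
  have h1 := _root_.abs_le.1 (hf.abs_le z hz w hw)
  have h2 := _root_.abs_le.1 (hf.abs_le z hz w' hw')
  exact _root_.abs_le.2 ⟨by linarith, by linarith⟩

lemma BoundedSmooth.integrable_sq (hf : BoundedSmooth X W f F Cg Ch) (hX : IsDomainSet X)
    {w w' : Vec dw} (hw : w ∈ W) (hw' : w' ∈ W) :
    Integrable (fun z => (f z w - f z w') ^ 2) (uniformLaw X) := by
  have := hX.isProbabilityMeasure_uniformLaw
  refine Integrable.of_bound
    (((hf.measurable_left w).sub (hf.measurable_left w')).pow_const 2).aestronglyMeasurable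
    ((2 * F) ^ 2) ?_
  filter_upwards [hX.ae_mem] with z hz
  have h := hf.abs_sub_le_two_mul hz hw hw'
  rw [Real.norm_of_nonneg (sq_nonneg _), ← sq_abs]
  gcongr

lemma BoundedSmooth.expectedLoss_le (hf : BoundedSmooth X W f F Cg Ch) (hX : IsDomainSet X)
    (hW : Realizable W wstar) {w w' : Vec dw} (hw : w ∈ W) (hw' : w' ∈ W) :
    expectedLoss X f wstar w
      ≤ expectedLoss X f wstar w' + 4 * F * (Cg * ‖w - w'‖) := by
  have := hX.isProbabilityMeasure_uniformLaw
  have h1 := hf.integrable_sq hX hw' hW.mem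
  have h2 : expectedLoss X f wstar w' + 4 * F * (Cg * ‖w - w'‖)
      = ∫ z, ((f z w' - f z wstar) ^ 2 + 4 * F * (Cg * ‖w - w'‖)) ∂(uniformLaw X) := by
    rw [integral_add h1 (integrable_const _)]
    simp [expectedLoss]
  rw [h2]
  refine integral_mono_ae (hf.integrable_sq hX hw hW.mem) (h1.add (integrable_const _)) ?_
  filter_upwards [hX.ae_mem] with z hz
  have a1 := hf.abs_sub_le hW.convex hz hw hw'
  have a2 := _root_.abs_le.1 (hf.abs_sub_le_two_mul hz hw hW.mem)
  have a3 := _root_.abs_le.1 (hf.abs_sub_le_two_mul hz hw' hW.mem)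
  have a4 : |(f z w - f z w') * ((f z w - f z wstar) + (f z w' - f z wstar))|
      ≤ (Cg * ‖w - w'‖) * (4 * F) := by
    rw [abs_mul]
    exact mul_le_mul a1 (_root_.abs_le.2 ⟨by linarith, by linarith⟩) (abs_nonneg _)
      ((abs_nonneg _).trans a1)
  have a5 := (_root_.abs_le.1 a4).2
  show (f z w - f z wstar) ^ 2 ≤ (f z w' - f z wstar) ^ 2 + 4 * F * (Cg * ‖w - w'‖)
  nlinarith

lemma empiricalLoss_eq {T₀ : ℕ} (N : ℕ) [NeZero N] (x : Fin T₀ → Vec dx) (y : Fin T₀ → ℝ)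
    (w : Vec dw) :
    empiricalLoss N f x y w = (1 / (T₀ : ℝ)) * ∑ s, (y s - f (x s) w) ^ 2 := by
  rw [empiricalLoss]
  congr 1
  exact Finset.sum_fiberwise Finset.univ (fun s : Fin T₀ => Fin.ofNat N s.val)
    fun s => (y s - f (x s) w) ^ 2

/-- On the event that all competitors `p c` of a net satisfy the one-sided deviation bound, an
approximate minimizer of the empirical loss has a small expected loss. -/
lemma expectedLoss_le_of_isApproxMinimizer {n N : ℕ} [NeZero N] (hn : 1 ≤ n)
    (hX : IsDomainSet X) (hW : Realizable W wstar) (hf : BoundedSmooth X W f F Cg Ch)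
    {x : Fin n → Vec dx} {η : Fin n → ℝ} {ε ρ U K : ℝ} (hx : ∀ s, x s ∈ X)
    (hη : ∀ s, |η s| ≤ U) {κ : Type*} {p : κ → Vec dw} (hp : ∀ c, p c ∈ W)
    (hnet : ∀ v ∈ W, ∃ c, ‖v - p c‖ ≤ ρ) (hCg : 0 ≤ Cg) (hF : 0 ≤ F) (hρ : n * (Cg * ρ) ≤ 1)
    (hdev : ∀ c, n / 4 * expectedLoss X f wstar (p c)
      ≤ ∑ s, ((f (x s) (p c) - f (x s) wstar) ^ 2
          - 2 * η s * (f (x s) (p c) - f (x s) wstar)) + K)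
    {w₀ : Vec dw}
    (hw₀ : IsApproxMinimizer (empiricalLoss N f x fun s => f (x s) wstar + η s) W ε w₀) :
    n / 4 * expectedLoss X f wstar w₀ ≤ n * ε + (5 * F + 2 * U) + K := by
  obtain ⟨hw₀W, v, hvW, hmin, hε⟩ := hw₀
  have hn0 : (0 : ℝ) < n := by exact_mod_cast hn
  obtain ⟨c, hc⟩ := hnet w₀ hw₀W
  have hCρ : Cg * ‖w₀ - p c‖ ≤ Cg * ρ := mul_le_mul_of_nonneg_left hc hCg
  have hU : 0 ≤ U := (abs_nonneg _).trans (hη ⟨0, hn⟩)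
  set Z : Vec dw → Fin n → ℝ := fun w s =>
    (f (x s) w - f (x s) wstar) ^ 2 - 2 * η s * (f (x s) w - f (x s) wstar) with hZ
  -- the approximate minimizer beats the true parameter up to `ε`
  have h1 : ∑ s, Z w₀ s ≤ n * ε := by
    have h2 := (_root_.abs_le.1 hε).2
    have h3 := isMinOn_iff.1 hmin wstar hW.mem
    simp only [empiricalLoss_eq] at h2 h3
    have h4 : (1 / (n : ℝ)) * ∑ s, Z w₀ s ≤ ε := by
      have h5 : ∑ s, Z w₀ s = ∑ s, (f (x s) wstar + η s - f (x s) w₀) ^ 2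
          - ∑ s, (f (x s) wstar + η s - f (x s) wstar) ^ 2 := by
        rw [← Finset.sum_sub_distrib]
        refine Finset.sum_congr rfl fun s _ => ?_
        simp only [hZ]
        ring
      rw [h5, mul_sub]
      linarith
    rw [one_div, inv_mul_le_iff₀ hn0] at h4
    exact h4
  -- passing from the minimizer to its neighbour in the net
  have h2 : ∑ s, Z (p c) s ≤ ∑ s, Z w₀ s + (4 * F + 2 * U) := by
    have h3 : ∀ s, Z (p c) s ≤ Z w₀ s + (4 * F + 2 * U) * (Cg * ρ) := fun s => by
      have a1 := (hf.abs_sub_le hW.convex (hx s) hw₀W (hp c)).trans hCρ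
      have a2 := _root_.abs_le.1 (hf.abs_sub_le_two_mul (hx s) hw₀W hW.mem)
      have a3 := _root_.abs_le.1 (hf.abs_sub_le_two_mul (hx s) (hp c) hW.mem)
      have a6 := _root_.abs_le.1 (hη s)
      have a4 : |(f (x s) w₀ - f (x s) (p c)) * ((f (x s) w₀ - f (x s) wstar)
          + (f (x s) (p c) - f (x s) wstar) - 2 * η s)| ≤ (Cg * ρ) * (4 * F + 2 * U) := by
        rw [abs_mul]
        exact mul_le_mul a1 (_root_.abs_le.2 ⟨by linarith, by linarith⟩) (abs_nonneg _)
          ((abs_nonneg _).trans a1)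
      have a5 := (_root_.abs_le.1 a4).1
      simp only [hZ]
      nlinarith
    calc ∑ s, Z (p c) s ≤ ∑ s, (Z w₀ s + (4 * F + 2 * U) * (Cg * ρ)) :=
          Finset.sum_le_sum fun s _ => h3 s
      _ = ∑ s, Z w₀ s + (4 * F + 2 * U) * (n * (Cg * ρ)) := by
          rw [Finset.sum_add_distrib, Finset.sum_const, Finset.card_univ, Fintype.card_fin,
            nsmul_eq_mul]
          ring
      _ ≤ ∑ s, Z w₀ s + (4 * F + 2 * U) := by
          have : (4 * F + 2 * U) * (n * (Cg * ρ)) ≤ (4 * F + 2 * U) * 1 :=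
            mul_le_mul_of_nonneg_left hρ (by positivity)
          linarith
  have h3 := hf.expectedLoss_le hX hW hw₀W (hp c)
  have h4 : n / 4 * expectedLoss X f wstar w₀
      ≤ n / 4 * expectedLoss X f wstar (p c) + F := by
    have h5 : n / 4 * (4 * F * (Cg * ‖w₀ - p c‖)) ≤ F := by
      calc n / 4 * (4 * F * (Cg * ‖w₀ - p c‖)) ≤ n / 4 * (4 * F * (Cg * ρ)) := by gcongr
        _ = F * (n * (Cg * ρ)) := by ring
        _ ≤ F * 1 := by gcongr
        _ = F := mul_one F
    have := mul_le_mul_of_nonneg_left h3 (by positivity : (0 : ℝ) ≤ n / 4)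
    linarith
  have h5 := hdev c
  linarith

/-- Union bound over the noise variables and over a finite family of competitors. -/
lemma measure_phaseOne_bad_le {Ω κ : Type*} {mΩ : MeasurableSpace Ω} [Fintype κ]
    {P : Measure Ω} [IsProbabilityMeasure P] {n : ℕ} {x : Fin n → Ω → Vec dx}
    {η : Fin n → Ω → ℝ} {b : ℝ} {c : ℝ≥0} (hb : 0 < b) (hFb : F ≤ b)
    (hX : IsDomainSet X) (hW : Realizable W wstar) (hf : BoundedSmooth X W f F Cg Ch)
    (hx : ∀ s, Measurable (x s)) (hη : ∀ s, Measurable (η s))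
    (hlaw : ∀ s, P.map (x s) = uniformLaw X)
    (hsamples : iIndepFun (fun s ω => (x s ω, η s ω)) P) (hnoise : ∀ s, IndepFun (x s) (η s) P)
    (hsub : ∀ s, HasSubgaussianMGF (η s) c P) (hc : (c : ℝ) ≤ b ^ 2)
    {p : κ → Vec dw} (hp : ∀ k, p k ∈ W) {u : ℝ} (hu : 0 ≤ u) (K : ℝ) :
    P {ω | ¬ ((∀ s, x s ω ∈ X) ∧ (∀ s, |η s ω| ≤ u * b) ∧
      ∀ k, n / 4 * expectedLoss X f wstar (p k)
        ≤ ∑ s, ((f (x s ω) (p k) - f (x s ω) wstar) ^ 2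
          - 2 * η s ω * (f (x s ω) (p k) - f (x s ω) wstar)) + 4 * b ^ 2 * K)}
      ≤ ENNReal.ofReal (n * (2 * Real.exp (-u ^ 2 / 2)) + Fintype.card κ * Real.exp (-K)) := by
  set A : Fin n → Set Ω := fun s => {ω | x s ω ∉ X}
  set B : Fin n → Set Ω := fun s => {ω | u * b < |η s ω|}
  set E : κ → Set Ω := fun k => {ω | ∑ s, ((f (x s ω) (p k) - f (x s ω) wstar) ^ 2
          - 2 * η s ω * (f (x s ω) (p k) - f (x s ω) wstar)) + 4 * b ^ 2 * K
        < n / 4 * expectedLoss X f wstar (p k)}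
  have hA : ∀ s, P (A s) = 0 := fun s => by
    have h := hX.ae_mem
    rw [← hlaw s] at h
    exact ae_of_ae_map (hx s).aemeasurable h
  have hB : ∀ s, P (B s) ≤ ENNReal.ofReal (2 * Real.exp (-u ^ 2 / 2)) := fun s =>
    measure_lt_abs_le (hsub s) hb hc hu
  have hE : ∀ k, P (E k) ≤ ENNReal.ofReal (Real.exp (-K)) := fun k => by
    refine measure_excess_lt_le hb hx hη hlaw hsamples hnoise hsub hc
      ((hf.measurable_left (p k)).sub (hf.measurable_left wstar)) ?_ K
    filter_upwards [hX.ae_mem] with z hz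
    exact (hf.abs_sub_le_two_mul hz (hp k) hW.mem).trans (by linarith)
  have hsubset : {ω | ¬ ((∀ s, x s ω ∈ X) ∧ (∀ s, |η s ω| ≤ u * b) ∧
      ∀ k, n / 4 * expectedLoss X f wstar (p k)
        ≤ ∑ s, ((f (x s ω) (p k) - f (x s ω) wstar) ^ 2
          - 2 * η s ω * (f (x s ω) (p k) - f (x s ω) wstar)) + 4 * b ^ 2 * K)}
      ⊆ (⋃ s, A s) ∪ ((⋃ s, B s) ∪ ⋃ k, E k) := by
    intro ω hω
    by_contra hcon
    simp only [Set.mem_union, Set.mem_iUnion, not_or, not_exists] at hcon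
    refine hω ⟨fun s => ?_, fun s => ?_, fun k => ?_⟩
    · exact not_not.1 (hcon.1 s)
    · exact not_lt.1 (hcon.2.1 s)
    · exact not_lt.1 (hcon.2.2 k)
  have hAu : P (⋃ s, A s) = 0 := by rw [measure_iUnion_null_iff]; exact hA
  have hBu : P (⋃ s, B s) ≤ ENNReal.ofReal (n * (2 * Real.exp (-u ^ 2 / 2))) :=
    (measure_iUnion_fintype_le P B).trans ((Finset.sum_le_sum fun s _ => hB s).trans (by
      rw [Finset.sum_const, Finset.card_univ, Fintype.card_fin, nsmul_eq_mul,
        ENNReal.ofReal_mul (Nat.cast_nonneg n), ENNReal.ofReal_natCast]))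
  have hEu : P (⋃ k, E k) ≤ ENNReal.ofReal (Fintype.card κ * Real.exp (-K)) :=
    (measure_iUnion_fintype_le P E).trans ((Finset.sum_le_sum fun k _ => hE k).trans (by
      rw [Finset.sum_const, Finset.card_univ, nsmul_eq_mul,
        ENNReal.ofReal_mul (Nat.cast_nonneg _), ENNReal.ofReal_natCast]))
  calc _ ≤ P ((⋃ s, A s) ∪ ((⋃ s, B s) ∪ ⋃ k, E k)) := measure_mono hsubset
    _ ≤ P (⋃ s, A s) + (P (⋃ s, B s) + P (⋃ k, E k)) :=
        (measure_union_le _ _).trans (by gcongr; exact measure_union_le _ _)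
    _ ≤ 0 + (ENNReal.ofReal (n * (2 * Real.exp (-u ^ 2 / 2)))
          + ENNReal.ofReal (Fintype.card κ * Real.exp (-K))) := by
        rw [hAu]; gcongr
    _ = _ := by
        rw [zero_add, ENNReal.ofReal_add (by positivity) (by positivity)]

/-- The growth condition turns a small loss into a small distance. Past the stated threshold for
`n`, the branch with exponent `γ` is at least as good as the quadratic one. -/
lemma mul_sq_le_of_min_le {μ τ γ n E r : ℝ} (hμ : 0 < μ) (hτ : 0 < τ) (hγ : 0 < γ) (hγ2 : γ < 2)
    (hn : 0 < n) (hE : 0 < E) (hr : 0 ≤ r)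
    (hmin : min (μ / 2 * r ^ 2) (τ / 2 * r ^ γ) ≤ E / n)
    (hlarge : 2 * E * (μ ^ (γ / (2 - γ)) / τ ^ (2 / (2 - γ))) ≤ n) :
    n * r ^ 2 ≤ 2 * E / μ := by
  rw [le_div_iff₀ hμ]
  rcases min_le_iff.1 hmin with h | h
  · rw [le_div_iff₀ hn] at h
    linarith
  rcases hr.eq_or_lt with rfl | hr
  · simp; positivity
  by_contra! hcon
  -- with `q = 2E/n`: `τ r^γ ≤ q < μ r²`, so `q^(2-γ) = q² / q^γ` exceeds `τ² / μ^γ`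
  set q := 2 * E / n with hq
  have hq0 : 0 < q := by positivity
  have h1 : τ * r ^ γ ≤ q := by
    rw [hq, le_div_iff₀ hn]
    rw [le_div_iff₀ hn] at h
    linarith
  have h2 : q < μ * r ^ 2 := by
    rw [hq, div_lt_iff₀ hn]
    linarith
  have h3 : 0 < 2 - γ := by linarith
  have h4 : q * (μ ^ (γ / (2 - γ)) / τ ^ (2 / (2 - γ))) ≤ 1 := by
    rw [hq, div_mul_eq_mul_div, div_le_one hn]
    exact hlarge
  have hlog1 : Real.log τ + γ * Real.log r ≤ Real.log q := by
    have := Real.log_le_log (by positivity) h1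
    rwa [Real.log_mul hτ.ne' (by positivity), Real.log_rpow hr] at this
  have hlog2 : Real.log q < Real.log μ + 2 * Real.log r := by
    have := Real.log_lt_log hq0 h2
    rwa [Real.log_mul hμ.ne' (by positivity), Real.log_pow, Nat.cast_ofNat] at this
  have hlog4 : Real.log q + (γ / (2 - γ) * Real.log μ - 2 / (2 - γ) * Real.log τ) ≤ 0 := by
    have := Real.log_le_log (by positivity) h4
    rwa [Real.log_mul hq0.ne' (by positivity),
      Real.log_div (Real.rpow_pos_of_pos hμ _).ne' (Real.rpow_pos_of_pos hτ _).ne',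
      Real.log_rpow hμ, Real.log_rpow hτ, Real.log_one] at this
  have h5 : (2 - γ) * Real.log q + γ * Real.log μ - 2 * Real.log τ ≤ 0 := by
    have := mul_le_mul_of_nonneg_left hlog4 h3.le
    have e : (2 - γ) * (Real.log q + (γ / (2 - γ) * Real.log μ - 2 / (2 - γ) * Real.log τ))
        = (2 - γ) * Real.log q + γ * Real.log μ - 2 * Real.log τ := by
      field_simp
      ring
    linarith
  nlinarith

end PhaseOne

/-! ### Self-normalized concentration in Phase II -/

section PhaseTwo

/-- Only joint measurability of `f` and differentiability on `W` are available; the directional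
derivatives are pointwise limits of difference quotients, hence measurable along the run. -/
lemma BoundedSmooth.measurable_inner_gradient {dx dw : ℕ} {X : Set (Vec dx)} {W : Set (Vec dw)}
    {f : Vec dx → Vec dw → ℝ} {F Cg Ch : ℝ} (hf : BoundedSmooth X W f F Cg Ch) {Ω : Type*}
    {m : MeasurableSpace Ω} {x : Ω → Vec dx} {w : Ω → Vec dw} (hx : Measurable x)
    (hw : Measurable w) (hxX : ∀ ω, x ω ∈ X) (hwW : ∀ ω, w ω ∈ W) (θ : Vec dw) :
    Measurable fun ω => inner ℝ (gradient (f (x ω)) (w ω)) θ := by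
  have hmeas : ∀ k : ℕ, Measurable fun ω =>
      (k : ℝ) • (f (x ω) (w ω + (k : ℝ)⁻¹ • θ) - f (x ω) (w ω)) := fun k =>
    ((hf.measurable.comp (hx.prodMk (hw.add_const ((k : ℝ)⁻¹ • θ)))).sub
      (hf.measurable.comp (hx.prodMk hw))).const_smul (k : ℝ)
  refine measurable_of_tendsto_metrizable hmeas (tendsto_pi_nhds.2 fun ω => ?_)
  have h := (hf.differentiableAt _ (hxX ω) _ (hwW ω)).hasFDerivAt.lim_real θ
  rw [gradient, InnerProductSpace.toDual_symm_apply]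
  exact h.comp tendsto_natCast_atTop_atTop

/-- If the exponent of the supermartingale is at most `K` in all directions of a net of a ball,
then the noise is controlled in all directions. Outside the ball the regularization dominates. -/
lemma sum_inner_mul_le_of_net {d : ℕ} {D : Finset ℕ} {g : ℕ → Vec d} {ξ : ℕ → ℝ}
    {lam M R K ρ A : ℝ} (hK : 0 ≤ K) (hA : 0 ≤ A) (hM : ‖∑ s ∈ D, ξ s • g s‖ ≤ M)
    (hMR : M ≤ lam * R) (hlam : 0 ≤ lam) {κ : Type*} {p : κ → Vec d}
    (hnet : ∀ v, ‖v‖ ≤ R → ∃ c, ‖v - p c‖ ≤ ρ)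
    (hp : ∀ c, ∑ s ∈ D, (inner ℝ (g s) (p c) * ξ s - inner ℝ (g s) (p c) ^ 2 / 2) ≤ K)
    (hρM : ρ * M ≤ A) (hρG : ρ ^ 2 * ∑ s ∈ D, ‖g s‖ ^ 2 ≤ A) (θ : Vec d) :
    ∑ s ∈ D, inner ℝ (g s) θ * ξ s
      ≤ lam * ‖θ‖ ^ 2 + ∑ s ∈ D, inner ℝ (g s) θ ^ 2 + (K + 2 * A) := by
  set S := ∑ s ∈ D, ξ s • g s with hS
  have hin : ∀ v : Vec d, ∑ s ∈ D, inner ℝ (g s) v * ξ s = inner ℝ S v := fun v => by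
    rw [hS, sum_inner]
    exact Finset.sum_congr rfl fun s _ => by rw [real_inner_smul_left, mul_comm]
  have hG0 : 0 ≤ ∑ s ∈ D, inner ℝ (g s) θ ^ 2 := Finset.sum_nonneg fun _ _ => sq_nonneg _
  rcases le_or_gt ‖θ‖ R with hθ | hθ
  · obtain ⟨c, hc⟩ := hnet θ hθ
    have h1 := hp c
    rw [Finset.sum_sub_distrib, hin, ← Finset.sum_div] at h1
    have h2 : inner ℝ S (θ - p c) ≤ A := by
      refine (real_inner_le_norm _ _).trans (le_trans ?_ hρM)
      rw [mul_comm]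
      exact mul_le_mul hc hM (norm_nonneg _) ((norm_nonneg _).trans hc)
    have h3 : ∑ s ∈ D, inner ℝ (g s) (θ - p c) ^ 2 ≤ A := by
      refine le_trans ?_ hρG
      rw [Finset.mul_sum]
      refine Finset.sum_le_sum fun s _ => ?_
      rw [← sq_abs, ← mul_pow]
      refine pow_le_pow_left₀ (abs_nonneg _) ((abs_real_inner_le_norm _ _).trans ?_) 2
      rw [mul_comm]
      exact mul_le_mul_of_nonneg_right hc (norm_nonneg _)
    have h4 : (∑ s ∈ D, inner ℝ (g s) (p c) ^ 2) / 2
        ≤ ∑ s ∈ D, inner ℝ (g s) θ ^ 2 + ∑ s ∈ D, inner ℝ (g s) (θ - p c) ^ 2 := by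
      rw [Finset.sum_div, ← Finset.sum_add_distrib]
      refine Finset.sum_le_sum fun s _ => ?_
      rw [inner_sub_right]
      nlinarith [sq_nonneg (2 * inner ℝ (g s) θ - inner ℝ (g s) (p c))]
    rw [inner_sub_right] at h2
    rw [hin]
    have := mul_nonneg hlam (sq_nonneg ‖θ‖)
    linarith
  · rw [hin]
    have h1 : inner ℝ S θ ≤ lam * ‖θ‖ ^ 2 := by
      calc inner ℝ S θ ≤ ‖S‖ * ‖θ‖ := real_inner_le_norm _ _
        _ ≤ (lam * ‖θ‖) * ‖θ‖ := by
            refine mul_le_mul_of_nonneg_right ?_ (norm_nonneg _)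
            exact hM.trans (hMR.trans (mul_le_mul_of_nonneg_left hθ.le hlam))
        _ = lam * ‖θ‖ ^ 2 := by ring
    linarith

/-- The scaling that turns a bound for normalized noise into one for noise of size `b`. -/
lemma sum_inner_mul_le_quarter {d : ℕ} {D : Finset ℕ} {g : ℕ → Vec d} {η : ℕ → ℝ} {lam b B : ℝ}
    (hb : 0 < b)
    (h : ∀ θ : Vec d, ∑ s ∈ D, inner ℝ (g s) θ * (η s / b)
      ≤ lam * ‖θ‖ ^ 2 + ∑ s ∈ D, inner ℝ (g s) θ ^ 2 + B) (θ : Vec d) :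
    ∑ s ∈ D, inner ℝ (g s) θ * η s
      ≤ (lam * ‖θ‖ ^ 2 + ∑ s ∈ D, inner ℝ (g s) θ ^ 2) / 4 + 4 * b ^ 2 * B := by
  have h1 := mul_le_mul_of_nonneg_left (h ((4 * b)⁻¹ • θ)) (by positivity : 0 ≤ 4 * b ^ 2)
  simp only [real_inner_smul_right, norm_smul, mul_pow, ← Finset.mul_sum] at h1
  have h2 : 4 * b ^ 2 * ∑ s ∈ D, (4 * b)⁻¹ * inner ℝ (g s) θ * (η s / b)
      = ∑ s ∈ D, inner ℝ (g s) θ * η s := by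
    rw [Finset.mul_sum]
    refine Finset.sum_congr rfl fun s _ => ?_
    field_simp
  rw [h2, Real.norm_of_nonneg (by positivity : (0 : ℝ) ≤ (4 * b)⁻¹)] at h1
  refine h1.trans (le_of_eq ?_)
  field_simp

/-- Union bound over the noise variables and, for the exponential supermartingale, over a finite
family of index sets and a finite set of directions. -/
lemma measure_phaseTwo_bad_le {Ω κ κ' : Type*} {mΩ : MeasurableSpace Ω} [Fintype κ] [Fintype κ']
    {P : Measure Ω} [IsProbabilityMeasure P] {ℱ : Filtration ℕ mΩ} {n d : ℕ}
    {g : ℕ → Ω → Vec d} {η : ℕ → Ω → ℝ} {b : ℝ} {c : ℝ≥0} (hb : 0 < b) (hc : (c : ℝ) ≤ b ^ 2)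
    (hg : ∀ t < n, ∀ θ : Vec d, Measurable[ℱ t] fun ω => (inner ℝ (g (t + 1) ω) θ : ℝ))
    (hη : ∀ t < n, Measurable[ℱ (t + 1)] (η (t + 1)))
    (hsub : ∀ t < n, HasSubgaussianMGF (η (t + 1)) c P)
    (hind : ∀ t < n, Indep (MeasurableSpace.comap (η (t + 1)) inferInstance) (ℱ t) P)
    {D : κ' → Finset ℕ} (hD : ∀ k, D k ⊆ Finset.Icc 1 n) (p : κ → Vec d) {u : ℝ} (hu : 0 ≤ u)
    (K : ℝ) :
    P {ω | ¬ ((∀ s ∈ Finset.Icc 1 n, |η s ω| ≤ u * b) ∧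
      ∀ k j, ∑ s ∈ D k, (inner ℝ (g s ω) (p j) * (η s ω / b) - inner ℝ (g s ω) (p j) ^ 2 / 2)
        ≤ K)}
      ≤ ENNReal.ofReal (n * (2 * Real.exp (-u ^ 2 / 2))
          + Fintype.card κ' * Fintype.card κ * Real.exp (-K)) := by
  set B : Fin n → Set Ω := fun s => {ω | u * b < |η (s + 1) ω|}
  set E : κ' × κ → Set Ω := fun k => {ω | K < ∑ s ∈ D k.1,
    (inner ℝ (g s ω) (p k.2) * (η s ω / b) - inner ℝ (g s ω) (p k.2) ^ 2 / 2)}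
  have hB : ∀ s, P (B s) ≤ ENNReal.ofReal (2 * Real.exp (-u ^ 2 / 2)) := fun s =>
    measure_lt_abs_le (hsub s s.2) hb hc hu
  have hE : ∀ k, P (E k) ≤ ENNReal.ofReal (Real.exp (-K)) := fun k => by
    have h := lintegral_exp_martingale_le_one (P := P) (ℱ := ℱ) (n := n)
      (a := fun s ω => inner ℝ (g s ω) (p k.2)) (ξ := fun s ω => η s ω / b)
      (fun t ht => hg t ht _) (fun t ht => (hη t ht).div_const b) (fun t ht => ?_)
      (fun t ht => ?_) (hD k.1)
    · exact measure_lt_le_of_lintegral_exp_le_one (h.1.mono (ℱ.le n) le_rfl).aemeasurable h.2 K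
    · have h1 := hasSubgaussianMGF_mono ((hsub t ht).const_mul b⁻¹) (c' := 1) (by
        change b⁻¹ ^ 2 * (c : ℝ) ≤ 1
        rw [inv_pow, inv_mul_le_iff₀ (by positivity), mul_one]
        exact hc)
      simpa only [div_eq_inv_mul] using h1
    · refine indep_of_indep_of_le_left (hind t ht) ?_
      exact Measurable.comap_le ((comap_measurable (η (t + 1))).div_const b)
  have hsubset : {ω | ¬ ((∀ s ∈ Finset.Icc 1 n, |η s ω| ≤ u * b) ∧
      ∀ k j, ∑ s ∈ D k, (inner ℝ (g s ω) (p j) * (η s ω / b) - inner ℝ (g s ω) (p j) ^ 2 / 2)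
        ≤ K)} ⊆ (⋃ s, B s) ∪ ⋃ k, E k := by
    intro ω hω
    by_contra hcon
    simp only [Set.mem_union, Set.mem_iUnion, not_or, not_exists] at hcon
    refine hω ⟨fun s hs => ?_, fun k j => ?_⟩
    · obtain ⟨hs1, hs2⟩ := Finset.mem_Icc.1 hs
      obtain ⟨s, rfl⟩ : ∃ r, s = r + 1 := ⟨s - 1, by omega⟩
      exact not_lt.1 (hcon.1 ⟨s, by omega⟩)
    · exact not_lt.1 (hcon.2 (k, j))
  have hBu : P (⋃ s, B s) ≤ ENNReal.ofReal (n * (2 * Real.exp (-u ^ 2 / 2))) :=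
    (measure_iUnion_fintype_le P B).trans ((Finset.sum_le_sum fun s _ => hB s).trans (by
      rw [Finset.sum_const, Finset.card_univ, Fintype.card_fin, nsmul_eq_mul,
        ENNReal.ofReal_mul (Nat.cast_nonneg n), ENNReal.ofReal_natCast]))
  have hEu : P (⋃ k, E k)
      ≤ ENNReal.ofReal (Fintype.card κ' * Fintype.card κ * Real.exp (-K)) :=
    (measure_iUnion_fintype_le P E).trans ((Finset.sum_le_sum fun k _ => hE k).trans (by
      rw [Finset.sum_const, Finset.card_univ, Fintype.card_prod, nsmul_eq_mul, ← Nat.cast_mul,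
        ENNReal.ofReal_mul (Nat.cast_nonneg _), ENNReal.ofReal_natCast]))
  calc _ ≤ P ((⋃ s, B s) ∪ ⋃ k, E k) := measure_mono hsubset
    _ ≤ P (⋃ s, B s) + P (⋃ k, E k) := measure_union_le _ _
    _ ≤ _ := add_le_add hBu hEu
    _ = _ := (ENNReal.ofReal_add (by positivity) (by positivity)).symm

end PhaseTwo

/-! ### The logarithmic factor and the failure probabilities -/

lemma exp_logFactor_mul {N T d : ℕ} {Cg δ : ℝ} (hN : 1 ≤ N) (hT : 1 ≤ T) (hd : 1 ≤ d)
    (hCg : 0 < Cg) (hδ : 0 < δ) :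
    Real.exp (logFactor N T d Cg δ) * δ = 3 * (N * T * d * (1 + Cg)) := by
  have hN' : (0 : ℝ) < N := by exact_mod_cast hN
  have hT' : (0 : ℝ) < T := by exact_mod_cast hT
  have hd' : (0 : ℝ) < d := by exact_mod_cast hd
  rw [logFactor, Real.exp_log (by positivity)]
  field_simp

lemma one_le_logFactor {N T d : ℕ} {Cg δ : ℝ} (hN : 1 ≤ N) (hT : 1 ≤ T) (hd : 1 ≤ d)
    (hCg : 0 < Cg) (hδ : 0 < δ) (hδ1 : δ < 1) : 1 ≤ logFactor N T d Cg δ := by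
  have hN' : (1 : ℝ) ≤ N := by exact_mod_cast hN
  have hT' : (1 : ℝ) ≤ T := by exact_mod_cast hT
  have hd' : (1 : ℝ) ≤ d := by exact_mod_cast hd
  have h1 : 1 ≤ (N : ℝ) * T * d * (1 + Cg) :=
    one_le_mul_of_one_le_of_one_le (one_le_mul_of_one_le_of_one_le
      (one_le_mul_of_one_le_of_one_le hN' hT') hd') (by linarith)
  have h2 : Real.exp 1 ≤ 3 * N * T * d * (1 + Cg) / δ := by
    rw [le_div_iff₀ hδ]
    nlinarith [Real.exp_one_lt_d9, Real.exp_pos 1]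
  rw [logFactor, Real.le_log_iff_exp_le (lt_of_lt_of_le (Real.exp_pos 1) h2)]
  exact h2

lemma exp_neg_two_mul_sq_le {ι : ℝ} (hι : 1 ≤ ι) :
    Real.exp (-(2 * ι) ^ 2 / 2) ≤ (Real.exp ι ^ 2)⁻¹ := by
  rw [← Real.exp_nat_mul, ← Real.exp_neg]
  refine Real.exp_le_exp.2 ?_
  push_cast
  nlinarith

lemma phaseOne_budget {n m d : ℕ} {ι δ : ℝ} (hι : 1 ≤ ι) (hδ : 0 < δ) (hn : 1 ≤ n)
    (hY : 3 ≤ Real.exp ι) (hnY : 3 * (n : ℝ) ≤ Real.exp ι * δ) (hm : (m : ℝ) ≤ Real.exp ι) :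
    n * (2 * Real.exp (-(2 * ι) ^ 2 / 2)) + (m : ℝ) ^ d * Real.exp (-((d + 2) * ι)) ≤ δ / 2 := by
  set Y := Real.exp ι with hYdef
  have hY0 : 0 < Y := Real.exp_pos ι
  have hn1 : (1 : ℝ) ≤ n := by exact_mod_cast hn
  have h1 := exp_neg_two_mul_sq_le hι
  have h2 : (m : ℝ) ^ d * Real.exp (-((d + 2) * ι)) ≤ (Y ^ 2)⁻¹ := by
    have h3 : Real.exp (-((d + 2) * ι)) = (Y ^ (d + 2))⁻¹ := by
      rw [hYdef, ← Real.exp_nat_mul, ← Real.exp_neg]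
      push_cast
      rfl
    rw [h3, pow_add, mul_inv, ← mul_assoc]
    refine mul_le_of_le_one_left (by positivity) ?_
    rw [mul_inv_le_iff₀ (by positivity), one_mul]
    gcongr
  calc _ ≤ n * (2 * (Y ^ 2)⁻¹) + (Y ^ 2)⁻¹ := by gcongr
    _ ≤ 3 * n * (Y ^ 2)⁻¹ := by nlinarith [inv_pos.2 (pow_pos hY0 2)]
    _ ≤ (Y * δ) * (Y ^ 2)⁻¹ := by gcongr
    _ = δ / Y := by field_simp
    _ ≤ δ / 2 := by gcongr; linarith

lemma phaseOne_radius_le {s F d ι e B : ℝ} (hs : 1 ≤ s) (hF : 1 ≤ F) (hd : 1 ≤ d) (hι : 1 ≤ ι)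
    (he : 0 < e)
    (hB : B ≤ 4 * (1 / e + (5 * F + 2 * (2 * ι * (s * F))) + 4 * (s * F) ^ 2 * ((d + 2) * ι))) :
    B ≤ (84 * s ^ 2 + 4 / e) * (d * F ^ 2 * ι) := by
  set G := d * F ^ 2 * ι with hG
  have hF2 : F ≤ F ^ 2 := le_self_pow₀ hF two_ne_zero
  have hss : s ≤ s ^ 2 := le_self_pow₀ hs two_ne_zero
  have hFG : F ^ 2 * ι ≤ G := by
    rw [hG]
    exact mul_le_mul_of_nonneg_right (le_mul_of_one_le_left (by positivity) hd) (by linarith)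
  have hFι : F * ι ≤ G := (mul_le_mul_of_nonneg_right hF2 (by linarith)).trans hFG
  have hF1 : F ≤ G := (le_mul_of_one_le_right (by linarith) hι).trans hFι
  have hG1 : 1 ≤ G := hF.trans hF1
  have a1 : F ≤ s ^ 2 * G := hF1.trans (le_mul_of_one_le_left (by linarith) (hs.trans hss))
  have a2 : ι * (s * F) ≤ s ^ 2 * G := by
    calc ι * (s * F) = s * (F * ι) := by ring
      _ ≤ s ^ 2 * G := by gcongr
  have a3 : 4 * (s * F) ^ 2 * ((d + 2) * ι) ≤ 12 * (s ^ 2 * G) := by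
    calc 4 * (s * F) ^ 2 * ((d + 2) * ι) ≤ 4 * (s * F) ^ 2 * ((d + 2 * d) * ι) := by
          gcongr
          linarith
      _ = 12 * (s ^ 2 * G) := by rw [hG]; ring
  have a4 : 4 * (1 / e) ≤ 4 / e * G := by
    rw [mul_one_div]
    exact le_mul_of_one_le_right (by positivity) hG1
  linarith

lemma phaseTwo_budget {Q N m d : ℕ} {ι δ A : ℝ} (hι : 1 ≤ ι) (hδ : 0 < δ) (hδ1 : δ < 1)
    (hQ : 1 ≤ Q) (hNQ : N ≤ Q) (hA : 0 < A)
    (hY : 3 ≤ Real.exp ι) (hQY : 3 * (Q : ℝ) ≤ Real.exp ι * δ)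
    (hm : (m : ℝ) ≤ A * Real.exp ι ^ 4) :
    Q * (2 * Real.exp (-(2 * ι) ^ 2 / 2))
      + (((Q + 1) * ((Q + 1) * N) : ℕ) : ℝ) * (m : ℝ) ^ d
        * Real.exp (-(d * Real.log A + 4 * d * ι + 4 * ι)) ≤ δ / 2 := by
  set Y := Real.exp ι with hYdef
  have hY0 : 0 < Y := Real.exp_pos ι
  have hQ1 : (1 : ℝ) ≤ Q := by exact_mod_cast hQ
  have hNQ' : (N : ℝ) ≤ Q := by exact_mod_cast hNQ
  have h1 := exp_neg_two_mul_sq_le hι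
  have h2 : (m : ℝ) ^ d * Real.exp (-(d * Real.log A + 4 * d * ι + 4 * ι)) ≤ (Y ^ 4)⁻¹ := by
    have h3 : Real.exp (-(d * Real.log A + 4 * d * ι + 4 * ι)) = ((A * Y ^ 4) ^ d)⁻¹ * (Y ^ 4)⁻¹ := by
      rw [Real.exp_neg, Real.exp_add, Real.exp_add, Real.exp_nat_mul, Real.exp_log hA, mul_inv,
        mul_pow, ← pow_mul, hYdef, ← Real.exp_nat_mul, ← Real.exp_nat_mul]
      push_cast
      rfl
    rw [h3, ← mul_assoc]
    refine mul_le_of_le_one_left (by positivity) ?_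
    rw [mul_inv_le_iff₀ (by positivity), one_mul]
    gcongr
  have h4 : (((Q + 1) * ((Q + 1) * N) : ℕ) : ℝ) ≤ 4 * (Q : ℝ) ^ 3 := by
    push_cast
    calc ((Q : ℝ) + 1) * ((Q + 1) * N) ≤ (Q + Q) * ((Q + Q) * Q) := by gcongr
      _ = 4 * (Q : ℝ) ^ 3 := by ring
  have h5 : (Q : ℝ) * (Y ^ 2)⁻¹ ≤ δ / 9 := by
    rw [mul_inv_le_iff₀ (by positivity)]
    nlinarith [mul_le_mul_of_nonneg_left hY (mul_pos hY0 hδ).le]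
  have h6 : (Q : ℝ) ^ 3 * (Y ^ 4)⁻¹ ≤ δ / 27 := by
    have e : (Q : ℝ) ^ 3 * (Y ^ 4)⁻¹ = (Q * (Y ^ 2)⁻¹) * (Q * Y⁻¹) ^ 2 := by
      field_simp
    have h7 : (Q : ℝ) * Y⁻¹ ≤ 1 / 3 := by
      rw [mul_inv_le_iff₀ hY0]
      nlinarith
    have h8 : ((Q : ℝ) * Y⁻¹) ^ 2 ≤ 1 / 3 := by
      have : 0 ≤ (Q : ℝ) * Y⁻¹ := by positivity
      nlinarith
    rw [e]
    calc _ ≤ (δ / 9) * (1 / 3) := by gcongr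
      _ = δ / 27 := by ring
  calc _ ≤ Q * (2 * (Y ^ 2)⁻¹) + (4 * (Q : ℝ) ^ 3) * (Y ^ 4)⁻¹ := by
        rw [mul_assoc (((Q + 1) * ((Q + 1) * N) : ℕ) : ℝ)]
        gcongr
    _ ≤ δ / 2 := by linarith

lemma sqrt_le_self_of_one_le {d : ℕ} (hd : 1 ≤ d) : Real.sqrt d ≤ d := by
  have hd' : (1 : ℝ) ≤ d := by exact_mod_cast hd
  rw [Real.sqrt_le_left (by linarith)]
  nlinarith

lemma phaseOneLength_le {N T : ℕ} : phaseOneLength N T ≤ N * T := by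
  rcases Nat.eq_zero_or_pos (N * T) with h | h
  · have h' : (N : ℝ) * T = 0 := by exact_mod_cast h
    simp [phaseOneLength, h']
  · refine Nat.ceil_le.2 ?_
    have := sqrt_le_self_of_one_le h
    push_cast at this ⊢
    exact this

/-! ### Uniform events for the two phases of a run -/

section Run

variable {dx dw N T : ℕ} [NeZero N] {X : Set (Vec dx)} {W : Set (Vec dw)}
  {f : Vec dx → Vec dw → ℝ} {wstar : Vec dw} {F Cg Ch lam thr β ε δ : ℝ} {σ : ℝ≥0}
  {Ω : Type*} {mΩ : MeasurableSpace Ω} {P : Measure Ω} [IsProbabilityMeasure P]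
  {ℱ : Filtration ℕ mΩ} {x₁ : Fin (phaseOneLength N T) → Ω → Vec dx}
  {η₁ : Fin (phaseOneLength N T) → Ω → ℝ} {w₀ : Ω → Vec dw} {x : ℕ → Ω → Vec dx}
  {η : ℕ → Ω → ℝ}

/-- With high probability every approximate minimizer of the empirical loss has an expected loss
of the fast order `1 / T₀`. -/
lemma IsRun.measure_not_expectedLoss_le {κ Ceps : ℝ}
    (hR : IsRun P ℱ X W f wstar σ N T (phaseOneLength N T) lam thr β ε x₁ η₁ w₀ x η)
    (hT : 1 ≤ T) (hd : 1 ≤ dw) (hX : IsDomainSet X) (hW : Realizable W wstar) (hF : 1 ≤ F)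
    (hCg : 0 < Cg) (hf : BoundedSmooth X W f F Cg Ch) (hκ : 0 < κ) (hσ : (σ : ℝ) ≤ κ * F)
    (hδ : 0 < δ) (hδ1 : δ < 1) (hCeps : 0 < Ceps) (hε : ε ≤ 1 / (Ceps * phaseOneLength N T)) :
    P {ω | ¬ ∀ w, IsApproxMinimizer
        (empiricalLoss N f (fun s => x₁ s ω) (fun s => f (x₁ s ω) wstar + η₁ s ω)) W ε w →
      phaseOneLength N T * expectedLoss X f wstar w
        ≤ (84 * (κ + 1) ^ 2 + 4 / Ceps) * (dw * F ^ 2 * logFactor N T dw Cg δ)}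
      ≤ ENNReal.ofReal (δ / 2) := by
  have hN : 1 ≤ N := NeZero.one_le
  have hι := one_le_logFactor hN hT hd hCg hδ hδ1
  have hYδ := exp_logFactor_mul hN hT hd hCg hδ
  set ι := logFactor N T dw Cg δ
  set Y := Real.exp ι with hYdef
  have hY0 : 0 < Y := Real.exp_pos ι
  set n := phaseOneLength N T with hn
  have hQ1 : 1 ≤ (N : ℝ) * T := by exact_mod_cast Nat.mul_pos hN hT
  have hnQ : (n : ℝ) ≤ N * T := by exact_mod_cast phaseOneLength_le (N := N) (T := T)
  have hn1 : 1 ≤ n := Nat.ceil_pos.2 (Real.sqrt_pos.2 (by linarith))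
  have hn1' : (1 : ℝ) ≤ n := by exact_mod_cast hn1
  have hd' : (1 : ℝ) ≤ dw := by exact_mod_cast hd
  set M₀ : ℝ := N * T * dw * (1 + Cg) with hM₀
  have hQd : (N : ℝ) * T ≤ N * T * dw := le_mul_of_one_le_right (by linarith) hd'
  have hQM : (N : ℝ) * T ≤ M₀ := hQd.trans (le_mul_of_one_le_right (by linarith) (by linarith))
  have hY3 : 3 ≤ Y := by nlinarith
  have hYM : 3 * M₀ ≤ Y := by nlinarith
  have hM₀0 : 0 < M₀ := by linarith
  set b := (κ + 1) * F with hb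
  have hb0 : 0 < b := by positivity
  have hFb : F ≤ b := by rw [hb]; nlinarith
  have hcb : ((σ ^ 2 : ℝ≥0) : ℝ) ≤ b ^ 2 := by
    rw [NNReal.coe_pow]
    have : (σ : ℝ) ≤ b := by rw [hb]; linarith
    gcongr
  -- mesh `√d / M₀`: replacing `w` by a net point moves the `T₀` predictions by at most `1` in total
  set m := ⌊2 * 1 / (1 / M₀)⌋₊ + 1 with hm
  obtain ⟨p, hp, hnet⟩ := exists_grid_net (d := dw) (m := m) (R := 1) (h := 1 / M₀) (A := W)
    (by positivity) (by rw [hm]; push_cast; exact Nat.lt_floor_add_one _) ⟨wstar, hW.mem⟩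
    fun v hv j => abs_le.2 ⟨by linarith [(hW.subset_cube hv j).1], (hW.subset_cube hv j).2⟩
  have hmY : (m : ℝ) ≤ Y := by
    have h1 : (⌊2 * 1 / (1 / M₀)⌋₊ : ℝ) ≤ 2 * 1 / (1 / M₀) := Nat.floor_le (by positivity)
    have h2 : 2 * 1 / (1 / M₀) = 2 * M₀ := by field_simp
    rw [hm]
    push_cast
    linarith
  have hρ : n * (Cg * (Real.sqrt dw * (1 / M₀))) ≤ 1 := by
    have h1 : n * (Cg * (Real.sqrt dw * (1 / M₀))) = n * Real.sqrt dw * Cg / M₀ := by ring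
    rw [h1, div_le_one hM₀0, hM₀]
    have := sqrt_le_self_of_one_le hd
    gcongr
    linarith
  have hbad := measure_phaseOne_bad_le (κ := Fin dw → Fin m) hb0 hFb hX hW hf
    (fun s => (hR.x₁_measurable s).mono (ℱ.le 0) le_rfl)
    (fun s => (hR.η₁_measurable s).mono (ℱ.le 0) le_rfl) hR.x₁_law hR.indep_samples
    hR.indep_noise hR.η₁_subgaussian hcb hp (u := 2 * ι) (by linarith) ((dw + 2) * ι)
  refine ((measure_mono ?_).trans hbad).trans (ENNReal.ofReal_le_ofReal ?_)
  · refine fun ω hω hω' => hω fun w hw => ?_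
    have h := expectedLoss_le_of_isApproxMinimizer hn1 hX hW hf hω'.1 hω'.2.1 hp hnet hCg.le
      (by linarith) hρ hω'.2.2 hw
    have h1 : n * ε ≤ 1 / Ceps := by
      have := mul_le_mul_of_nonneg_left hε (by positivity : (0 : ℝ) ≤ n)
      refine this.trans (le_of_eq ?_)
      field_simp
    refine phaseOne_radius_le (by linarith) hF hd' hι hCeps ?_
    rw [← hb]
    linarith
  · have h1 : (Fintype.card (Fin dw → Fin m) : ℝ) = (m : ℝ) ^ dw := by simp
    rw [h1]
    refine phaseOne_budget hι hδ hn1 hY3 ?_ hmY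
    rw [hYδ]
    linarith

/-- With high probability the noise of Phase II is controlled in all directions simultaneously, for
all the index sets that clients can hold. -/
lemma IsRun.measure_not_noise_le {Clam b : ℝ}
    (hR : IsRun P ℱ X W f wstar σ N T (phaseOneLength N T) lam thr β ε x₁ η₁ w₀ x η)
    (hT : 1 ≤ T) (hd : 1 ≤ dw) (hCg : 0 < Cg) (hf : BoundedSmooth X W f F Cg Ch)
    (hδ : 0 < δ) (hδ1 : δ < 1) (hClam : 0 < Clam) (hlam : Clam ≤ lam) (hb : 0 < b)
    (hσb : (σ : ℝ) ^ 2 ≤ b ^ 2) :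
    P {ω | ¬ ∀ τ ≤ N * T, ∀ t ≤ N * T, ∀ i : Fin N, ∀ θ : Vec dw,
      ∑ s ∈ sharedSet N τ t i, inner ℝ ((trajectoryAt f wstar w₀ x η ω).grad f s) θ * η s ω
        ≤ sqNorm ((trajectoryAt f wstar w₀ x η ω).sigma f lam (sharedSet N τ t i)) θ / 4
          + 4 * b ^ 2 * ((Real.log (8 / Clam + 1) + 10) * (dw * logFactor N T dw Cg δ))}
      ≤ ENNReal.ofReal (δ / 2) := by
  have hN : 1 ≤ N := NeZero.one_le
  have hι := one_le_logFactor hN hT hd hCg hδ hδ1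
  have hYδ := exp_logFactor_mul hN hT hd hCg hδ
  set ι := logFactor N T dw Cg δ
  set Y := Real.exp ι with hYdef
  have hY0 : 0 < Y := Real.exp_pos ι
  have hιY : ι ≤ Y := by linarith [Real.add_one_le_exp ι]
  have hd' : (1 : ℝ) ≤ dw := by exact_mod_cast hd
  have hQnat : 1 ≤ N * T := Nat.mul_pos hN hT
  set Q := N * T with hQ
  have hQcast : (Q : ℝ) = N * T := by rw [hQ]; push_cast; rfl
  rw [← hQcast] at hYδ
  have hQ1 : (1 : ℝ) ≤ Q := by exact_mod_cast hQnat
  have hQd : (Q : ℝ) ≤ Q * dw := le_mul_of_one_le_right (by linarith) hd'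
  have hQCg : (Q : ℝ) * (1 + Cg) ≤ Q * dw * (1 + Cg) := by gcongr
  have hY3 : 3 ≤ Y := by nlinarith
  have hQY : Q * Cg ≤ Y := by nlinarith
  -- `M` bounds the normalized noise vector `∑ ∇_s η_s / b`, and the net has mesh `√d / M`
  set M := 2 * Y ^ 2 with hM
  have hM0 : 0 < M := by positivity
  set R := M / Clam with hRdef
  set A := 8 / Clam + 1 with hA
  have hA1 : 1 ≤ A := by rw [hA]; linarith [show 0 < 8 / Clam by positivity]
  have hlogA : 0 ≤ Real.log A := Real.log_nonneg hA1
  have hmeshpos : 0 ≤ 2 * R / (1 / M) := by positivity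
  set m := ⌊2 * R / (1 / M)⌋₊ + 1 with hm
  obtain ⟨p, -, hnet⟩ := exists_grid_net (d := dw) (m := m) (R := R) (h := 1 / M)
    (A := {v : Vec dw | ‖v‖ ≤ R}) (by positivity)
    (by rw [hm]; push_cast; exact Nat.lt_floor_add_one _)
    ⟨0, show ‖(0 : Vec dw)‖ ≤ R by rw [norm_zero]; positivity⟩
    fun v hv j => (PiLp.norm_apply_le v j).trans hv
  have hmA : (m : ℝ) ≤ A * Y ^ 4 := by
    have h1 : (⌊2 * R / (1 / M)⌋₊ : ℝ) ≤ 2 * R / (1 / M) := Nat.floor_le hmeshpos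
    have h2 : 2 * R / (1 / M) = 8 / Clam * Y ^ 4 := by
      rw [hRdef, hM]
      field_simp
      ring
    have h3 : 1 ≤ Y ^ 4 := one_le_pow₀ (by linarith)
    rw [hm, hA]
    push_cast
    linarith
  set K := dw * Real.log A + 4 * dw * ι + 4 * ι with hK
  have hK0 : 0 ≤ K := by positivity
  have hxX : ∀ t < Q, ∀ ω, x (t + 1) ω ∈ X := fun t ht ω => (hR.x_optimistic t ht ω).1
  have hbad := measure_phaseTwo_bad_le (κ := Fin dw → Fin m)
    (κ' := Fin (Q + 1) × Fin (Q + 1) × Fin N) (P := P) (ℱ := ℱ) (n := Q) (c := σ ^ 2)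
    (g := fun s ω => (trajectoryAt f wstar w₀ x η ω).grad f s) (η := η) hb
    (by rw [NNReal.coe_pow]; exact hσb)
    (fun t ht θ => hf.measurable_inner_gradient (hR.x_measurable t ht)
      (hR.w₀_measurable.mono (ℱ.mono (Nat.zero_le t)) le_rfl) (hxX t ht) hR.w₀_mem θ)
    hR.η_measurable hR.η_subgaussian hR.η_indep
    (D := fun k => sharedSet N k.1 k.2.1 k.2.2)
    (fun k => (Finset.filter_subset _ _).trans
      (Finset.Icc_subset_Icc_right (Nat.lt_succ_iff.1 k.2.1.2)))
    p (u := 2 * ι) (by linarith) K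
  refine ((measure_mono ?_).trans hbad).trans (ENNReal.ofReal_le_ofReal ?_)
  · refine fun ω hω hω' => hω fun τ hτ t ht i θ => ?_
    set D := sharedSet N τ t i with hD
    have hDsub : D ⊆ Finset.Icc 1 Q :=
      (Finset.filter_subset _ _).trans (Finset.Icc_subset_Icc_right ht)
    have hDcard : (D.card : ℝ) ≤ Q := by
      have := Finset.card_le_card hDsub
      rw [Nat.card_Icc] at this
      exact_mod_cast this
    have hgrad : ∀ s ∈ D, ‖(trajectoryAt f wstar w₀ x η ω).grad f s‖ ≤ Cg := fun s hs => by
      obtain ⟨hs1, hs2⟩ := Finset.mem_Icc.1 (hDsub hs)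
      obtain ⟨s, rfl⟩ : ∃ r, s = r + 1 := ⟨s - 1, by omega⟩
      exact hf.norm_gradient_le _ (hxX s (by omega) ω) _ (hR.w₀_mem ω)
    have hnoise : ∀ s ∈ D, |η s ω / b| ≤ 2 * ι := fun s hs => by
      rw [abs_div, abs_of_pos hb, div_le_iff₀ hb]
      exact hω'.1 s (hDsub hs)
    have hall := sum_inner_mul_le_of_net (D := D)
      (g := fun s => (trajectoryAt f wstar w₀ x η ω).grad f s) (ξ := fun s => η s ω / b)
      (lam := lam) (M := M) (R := R) (ρ := Real.sqrt dw * (1 / M)) (A := dw) hK0 (by positivity)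
      ?_ ?_ (by linarith) hnet (fun j => hω'.2 (⟨τ, by omega⟩, ⟨t, by omega⟩, i) j) ?_ ?_
    · have h := sum_inner_mul_le_quarter hb hall θ
      rw [Trajectory.sqNorm_sigma]
      refine h.trans (add_le_add le_rfl (mul_le_mul_of_nonneg_left ?_ (by positivity)))
      have a1 : dw * Real.log A ≤ Real.log A * (dw * ι) := by
        rw [mul_comm]
        exact mul_le_mul_of_nonneg_left (le_mul_of_one_le_right (by positivity) hι) hlogA
      have a2 : ι ≤ dw * ι := le_mul_of_one_le_left (by linarith) hd'
      have a3 : (dw : ℝ) ≤ dw * ι := le_mul_of_one_le_right (by linarith) hι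
      rw [hK]
      linarith
    · calc ‖∑ s ∈ D, (η s ω / b) • (trajectoryAt f wstar w₀ x η ω).grad f s‖
          ≤ ∑ s ∈ D, 2 * ι * Cg := by
            refine norm_sum_le_of_le _ fun s hs => ?_
            rw [norm_smul, Real.norm_eq_abs]
            exact mul_le_mul (hnoise s hs) (hgrad s hs) (norm_nonneg _) (by linarith)
        _ = D.card * (2 * ι * Cg) := by rw [Finset.sum_const, nsmul_eq_mul]
        _ ≤ Q * (2 * ι * Cg) := by gcongr
        _ = 2 * (ι * (Q * Cg)) := by ring
        _ ≤ 2 * (Y * Y) := by gcongr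
        _ = M := by rw [hM]; ring
    · have : M = Clam * R := by rw [hRdef]; field_simp
      rw [this]
      gcongr
    · have : Real.sqrt dw * (1 / M) * M = Real.sqrt dw := by field_simp
      rw [this]
      exact sqrt_le_self_of_one_le hd
    · have h1 : ∑ s ∈ D, ‖(trajectoryAt f wstar w₀ x η ω).grad f s‖ ^ 2 ≤ M ^ 2 := by
        calc _ ≤ ∑ s ∈ D, Cg ^ 2 := Finset.sum_le_sum fun s hs =>
              pow_le_pow_left₀ (norm_nonneg _) (hgrad s hs) 2
          _ = D.card * Cg ^ 2 := by rw [Finset.sum_const, nsmul_eq_mul]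
          _ ≤ Q * Cg ^ 2 := by gcongr
          _ ≤ Q * (Q * Cg ^ 2) := le_mul_of_one_le_left (by positivity) hQ1
          _ = (Q * Cg) ^ 2 := by ring
          _ ≤ Y ^ 2 := by gcongr
          _ ≤ M ^ 2 := by
            gcongr
            rw [hM]
            nlinarith
      calc (Real.sqrt dw * (1 / M)) ^ 2
            * ∑ s ∈ D, ‖(trajectoryAt f wstar w₀ x η ω).grad f s‖ ^ 2
          ≤ (Real.sqrt dw * (1 / M)) ^ 2 * M ^ 2 := by gcongr
        _ = (dw : ℝ) := by
            rw [mul_pow, Real.sq_sqrt (by positivity)]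
            field_simp
  · have h1 : (Fintype.card (Fin dw → Fin m) : ℝ) = (m : ℝ) ^ dw := by simp
    have h2 : (Fintype.card (Fin (Q + 1) × Fin (Q + 1) × Fin N) : ℝ)
        = (((Q + 1) * ((Q + 1) * N) : ℕ) : ℝ) := by simp
    rw [h1, h2]
    refine phaseTwo_budget hι hδ hδ1 hQnat (Nat.le_mul_of_pos_right N hT) (by linarith) hY3 ?_ hmA
    rw [hYδ]
    have : (Q : ℝ) * dw ≤ Q * dw * (1 + Cg) := le_mul_of_one_le_right (by positivity) (by linarith)
    linarith

end Run

/-! ### Assembling the confidence bound -/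

/-- The combination of the three error terms: linearization, noise, and regularization bias. -/
lemma two_mul_error_terms_le {d F ι μ σ2 Clam Ch E₀ A : ℝ} (hd : 1 ≤ d) (hF : 1 ≤ F)
    (hι : 1 ≤ ι) (hμ : 0 < μ) (hσ2 : 0 ≤ σ2) (hClam : 0 ≤ Clam) (hE₀ : 0 ≤ E₀) (hA : 0 ≤ A) :
    2 * (Ch ^ 2 * (2 * (E₀ * (d * F ^ 2 * ι)) / μ) ^ 2
        + 4 * (σ2 + F ^ 2 / μ) * (A * (d * ι))
        + Clam * (2 * (E₀ * (d * F ^ 2 * ι)) / μ))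
      ≤ (2 * E₀ + 8 * Ch ^ 2 * E₀ ^ 2 + 8 * A + 4 * Clam * E₀)
        * (d * σ2 + d * F ^ 2 / μ + d ^ 3 * F ^ 4 / μ ^ 2) * ι ^ 2 := by
  set a := d * σ2 * ι ^ 2 with ha
  set b := d * F ^ 2 / μ * ι ^ 2 with hb
  set c := d ^ 3 * F ^ 4 / μ ^ 2 * ι ^ 2 with hc
  have ha0 : 0 ≤ a := by positivity
  have hb0 : 0 ≤ b := by positivity
  have hc0 : 0 ≤ c := by positivity
  have hιι : ι ≤ ι ^ 2 := le_self_pow₀ hι two_ne_zero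
  have h1 : (2 * (E₀ * (d * F ^ 2 * ι)) / μ) ^ 2 ≤ 4 * E₀ ^ 2 * c := by
    calc (2 * (E₀ * (d * F ^ 2 * ι)) / μ) ^ 2
        = 4 * E₀ ^ 2 * (d ^ 2 * F ^ 4 / μ ^ 2 * ι ^ 2) := by ring
      _ ≤ 4 * E₀ ^ 2 * (d ^ 3 * F ^ 4 / μ ^ 2 * ι ^ 2) := by
        gcongr
        norm_num
      _ = 4 * E₀ ^ 2 * c := rfl
  have h2 : (σ2 + F ^ 2 / μ) * (A * (d * ι)) ≤ A * (a + b) := by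
    calc (σ2 + F ^ 2 / μ) * (A * (d * ι)) = A * ((d * σ2 + d * F ^ 2 / μ) * ι) := by ring
      _ ≤ A * ((d * σ2 + d * F ^ 2 / μ) * ι ^ 2) := by gcongr
      _ = A * (a + b) := by rw [ha, hb]; ring
  have h3 : 2 * (E₀ * (d * F ^ 2 * ι)) / μ ≤ 2 * E₀ * b := by
    calc 2 * (E₀ * (d * F ^ 2 * ι)) / μ = 2 * E₀ * (d * F ^ 2 / μ * ι) := by ring
      _ ≤ 2 * E₀ * (d * F ^ 2 / μ * ι ^ 2) := by gcongr
  have h4 : (2 * E₀ + 8 * Ch ^ 2 * E₀ ^ 2 + 8 * A + 4 * Clam * E₀)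
        * (d * σ2 + d * F ^ 2 / μ + d ^ 3 * F ^ 4 / μ ^ 2) * ι ^ 2
      = (2 * E₀ + 8 * Ch ^ 2 * E₀ ^ 2 + 8 * A + 4 * Clam * E₀) * (a + b + c) := by
    rw [ha, hb, hc]; ring
  have h5 : 2 * (Ch ^ 2 * (4 * E₀ ^ 2 * c) + 4 * (A * (a + b)) + Clam * (2 * E₀ * b))
      ≤ (2 * E₀ + 8 * Ch ^ 2 * E₀ ^ 2 + 8 * A + 4 * Clam * E₀) * (a + b + c) := by
    have t1 : 0 ≤ 2 * E₀ * (a + b + c) := by positivity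
    have t2 : 0 ≤ 8 * Ch ^ 2 * E₀ ^ 2 * (a + b) := by positivity
    have t3 : 0 ≤ 8 * A * c := by positivity
    have t4 : 0 ≤ 4 * Clam * E₀ * (a + c) := by positivity
    linarith
  rw [h4]
  refine le_trans ?_ h5
  have h6 := mul_le_mul_of_nonneg_left h1 (sq_nonneg Ch)
  have h7 := mul_le_mul_of_nonneg_left h3 hClam
  linarith

lemma ofReal_one_sub_le_measure {Ω : Type*} {mΩ : MeasurableSpace Ω} {P : Measure Ω}
    [IsProbabilityMeasure P] {B₀ B₁ B₂ good : Set Ω} {δ : ℝ} (hδ : 0 ≤ δ) (h₀ : P B₀ = 0)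
    (h₁ : P B₁ ≤ ENNReal.ofReal (δ / 2)) (h₂ : P B₂ ≤ ENNReal.ofReal (δ / 2))
    (hgood : ∀ ω, ω ∉ B₀ → ω ∉ B₁ → ω ∉ B₂ → ω ∈ good) :
    ENNReal.ofReal (1 - δ) ≤ P good := by
  have hsub : goodᶜ ⊆ B₀ ∪ (B₁ ∪ B₂) := fun ω hω => by
    by_contra hcon
    rw [Set.mem_union, Set.mem_union, not_or, not_or] at hcon
    exact hω (hgood ω hcon.1 hcon.2.1 hcon.2.2)
  have hcompl : P goodᶜ ≤ ENNReal.ofReal δ := by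
    calc P goodᶜ ≤ P (B₀ ∪ (B₁ ∪ B₂)) := measure_mono hsub
      _ ≤ P B₀ + (P B₁ + P B₂) :=
          (measure_union_le _ _).trans (add_le_add le_rfl (measure_union_le _ _))
      _ ≤ 0 + (ENNReal.ofReal (δ / 2) + ENNReal.ofReal (δ / 2)) :=
          add_le_add h₀.le (add_le_add h₁ h₂)
      _ = ENNReal.ofReal δ := by
          rw [zero_add, ← ENNReal.ofReal_add (by positivity) (by positivity), add_halves]
  have huniv : 1 ≤ P good + P goodᶜ := by
    rw [← measure_univ (μ := P), ← Set.union_compl_self good]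
    exact measure_union_le _ _
  rw [ENNReal.ofReal_sub _ hδ, ENNReal.ofReal_one, tsub_le_iff_right]
  exact huniv.trans (add_le_add le_rfl hcompl)

/-- On the good events, the confidence bound holds for every index set a client can hold. -/
lemma sqNorm_estimate_le_of_good {dx dw N Q n : ℕ} [NeZero N] {X : Set (Vec dx)}
    {W : Set (Vec dw)} {f : Vec dx → Vec dw → ℝ} {F Cg Ch lam B S : ℝ} {wstar w : Vec dw}
    {h : Trajectory dx dw} {η : ℕ → ℝ} (hW : Realizable W wstar)
    (hf : BoundedSmooth X W f F Cg Ch) (hCh : 0 ≤ Ch) (hlam : 0 < lam) (hw : h.w₀ = w)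
    (hwW : w ∈ W) (hx : ∀ s ∈ Finset.Icc 1 Q, h.x s ∈ X)
    (hy : ∀ s, h.y s = f (h.x s) wstar + η s) (hQn : (Q : ℝ) ≤ (n : ℝ) ^ 2)
    (hS : n * ‖w - wstar‖ ^ 2 ≤ S) {τ t : ℕ} (ht : t ≤ Q) (i : Fin N)
    (hη : ∀ θ : Vec dw, ∑ s ∈ sharedSet N τ t i, inner ℝ (h.grad f s) θ * η s
      ≤ sqNorm (h.sigma f lam (sharedSet N τ t i)) θ / 4 + B) :
    sqNorm (h.sigma f lam (sharedSet N τ t i)) (h.estimate f lam (sharedSet N τ t i) - wstar)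
      ≤ 2 * (Ch ^ 2 * S ^ 2 + B + lam * ‖w - wstar‖ ^ 2) := by
  subst hw
  set D := sharedSet N τ t i
  have hDsub : D ⊆ Finset.Icc 1 Q :=
    (Finset.filter_subset _ _).trans (Finset.Icc_subset_Icc_right ht)
  have hDcard : (D.card : ℝ) ≤ Q := by
    have := Finset.card_le_card hDsub
    rw [Nat.card_Icc] at this
    exact_mod_cast this
  refine h.sqNorm_estimate_le f D hlam wstar (η := η)
    (r := fun s => f (h.x s) wstar - f (h.x s) h.w₀ - inner ℝ (h.grad f s) (wstar - h.w₀))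
    (fun s _ => by rw [hy]; ring) ?_ hη
  calc ∑ s ∈ D, (f (h.x s) wstar - f (h.x s) h.w₀ - inner ℝ (h.grad f s) (wstar - h.w₀)) ^ 2
      ≤ ∑ s ∈ D, (Ch * ‖h.w₀ - wstar‖ ^ 2) ^ 2 := by
        refine Finset.sum_le_sum fun s hs => ?_
        rw [← sq_abs]
        refine pow_le_pow_left₀ (abs_nonneg _) ?_ 2
        rw [norm_sub_rev]
        exact hf.abs_remainder_le hW.convex (hx s (hDsub hs)) hW.mem hwW hCh
    _ = D.card * (Ch * ‖h.w₀ - wstar‖ ^ 2) ^ 2 := by rw [Finset.sum_const, nsmul_eq_mul]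
    _ ≤ (n : ℝ) ^ 2 * (Ch * ‖h.w₀ - wstar‖ ^ 2) ^ 2 := by
        gcongr
        exact hDcard.trans hQn
    _ = Ch ^ 2 * (n * ‖h.w₀ - wstar‖ ^ 2) ^ 2 := by ring
    _ ≤ Ch ^ 2 * S ^ 2 := by gcongr

end FedGOUCB

open FedGOUCB in
theorem mainTheorem2 :
    ∃ k : ℕ, ∀ Ch Clam κ Ceps : ℝ, 0 < Ch → 0 < Clam → 0 < κ → 0 < Ceps →
    ∃ C : ℝ, 0 < C ∧
    ∀ (dx dw N T : ℕ) [NeZero N] (_ : 1 ≤ T)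
      (X : Set (Vec dx)) (W : Set (Vec dw)) (f : Vec dx → Vec dw → ℝ) (wstar : Vec dw)
      (F Cg μ τ γ c ζ thr ε δ : ℝ) (σ : ℝ≥0),
      IsDomainSet X →
      Realizable W wstar →
      1 ≤ F → 0 < Cg → BoundedSmooth X W f F Cg Ch →
      GeometricLoss (expectedLoss X f wstar) W wstar μ τ γ c ζ →
      (σ : ℝ) ≤ κ * F →
      0 < δ → δ < 1 →
      ε ≤ 1 / (Ceps * phaseOneLength N T) →
      C * dw * F ^ 2 * logFactor N T dw Cg δ *
          max (μ ^ (γ / (2 - γ)) / τ ^ (2 / (2 - γ))) (ζ / (μ * c ^ 2))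
        ≤ phaseOneLength N T →
    ∀ (Ω : Type*) (mΩ : MeasurableSpace Ω) (P : Measure Ω) [IsProbabilityMeasure P]
      (ℱ : Filtration ℕ mΩ)
      (x₁ : Fin (phaseOneLength N T) → Ω → Vec dx) (η₁ : Fin (phaseOneLength N T) → Ω → ℝ)
      (w₀ : Ω → Vec dw) (x : ℕ → Ω → Vec dx) (η : ℕ → Ω → ℝ)
      (lam β : ℝ),
      lam = Clam * Real.sqrt (N * T) →
      β = radius C k dw σ F μ (logFactor N T dw Cg δ) →
      IsRun P ℱ X W f wstar σ N T (phaseOneLength N T) lam thr β ε x₁ η₁ w₀ x η →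
      ENNReal.ofReal (1 - δ) ≤ P {ω | ∀ t ∈ Finset.Icc 1 (N * T),
        (let h := trajectoryAt f wstar w₀ x η ω
         let D := h.activeSet f lam thr N t
         sqNorm (h.sigma f lam D) (h.estimate f lam D - wstar) ≤ β) ∧
        (∀ i : Fin N,
         let h := trajectoryAt f wstar w₀ x η ω
         let D := (h.clientSets f lam thr N t).cur i
         sqNorm (h.sigma f lam D) (h.estimate f lam D - wstar) ≤ β)} := by
  refine ⟨2, fun Ch Clam κ Ceps hCh hClam hκ hCeps => ?_⟩
  -- `T₀ L(w₀) ≤ E₀ d F² ι` in Phase I, and `A` bounds the complexity of the Phase II net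
  set E₀ : ℝ := 84 * (κ + 1) ^ 2 + 4 / Ceps with hE₀
  set A : ℝ := Real.log (8 / Clam + 1) + 10 with hA
  have hE₀0 : 0 < E₀ := by positivity
  have hA0 : 0 < A := by
    have : 0 ≤ Real.log (8 / Clam + 1) :=
      Real.log_nonneg (by linarith [show 0 < 8 / Clam by positivity])
    positivity
  refine ⟨2 * E₀ + 8 * Ch ^ 2 * E₀ ^ 2 + 8 * A + 4 * Clam * E₀, by positivity, ?_⟩
  intro dx dw N T _ hT X W f wstar F Cg μ τ γ c ζ thr ε δ σ hX hW hF hCg hf hgeo hσ hδ hδ1 hε hlarge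
    Ω mΩ P _ ℱ x₁ η₁ w₀ x η lam β hlam hβ hR
  have hN : 1 ≤ N := NeZero.one_le
  have hd : 1 ≤ dw := by
    rw [Nat.one_le_iff_ne_zero]
    rintro rfl
    have h1 := hgeo.μ_pos
    have h2 := hgeo.μ_lt
    push_cast at h2
    linarith
  have hd' : (1 : ℝ) ≤ dw := by exact_mod_cast hd
  have hμ := hgeo.μ_pos
  have hι := one_le_logFactor hN hT hd hCg hδ hδ1
  set C : ℝ := 2 * E₀ + 8 * Ch ^ 2 * E₀ ^ 2 + 8 * A + 4 * Clam * E₀ with hC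
  have hQ1 : 1 ≤ (N : ℝ) * T := by exact_mod_cast Nat.mul_pos hN hT
  have hsqrt1 : 1 ≤ Real.sqrt (N * T) := Real.one_le_sqrt.2 hQ1
  have hsqrtn : Real.sqrt (N * T) ≤ phaseOneLength N T := Nat.le_ceil _
  have hn0 : (0 : ℝ) < phaseOneLength N T := by linarith
  have hQn : ((N * T : ℕ) : ℝ) ≤ (phaseOneLength N T : ℝ) ^ 2 := by
    push_cast
    exact Real.sqrt_le_left hn0.le |>.1 hsqrtn
  have hlam0 : Clam ≤ lam := by
    rw [hlam]
    exact le_mul_of_one_le_right hClam.le hsqrt1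
  set G : ℝ := dw * F ^ 2 * logFactor N T dw Cg δ with hG
  have hG0 : 0 < G := by positivity
  -- adding `F² / μ` keeps the variance proxy positive when `σ = 0`; the radius has a term for it
  set v : ℝ := σ ^ 2 + F ^ 2 / μ with hv
  have hv0 : 0 < v := by positivity
  have hbv : Real.sqrt v ^ 2 = v := Real.sq_sqrt hv0.le
  have hbad₁ := hR.measure_not_expectedLoss_le hT hd hX hW hF hCg hf hκ hσ hδ hδ1 hCeps hε
  have hbad₂ := hR.measure_not_noise_le (b := Real.sqrt v) hT hd hCg hf hδ hδ1 hClam hlam0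
    (Real.sqrt_pos.2 hv0) (by
      rw [hbv, hv]
      linarith [show 0 < F ^ 2 / μ by positivity])
  rw [hbv] at hbad₂
  have hthr : 2 * (E₀ * G) * (μ ^ (γ / (2 - γ)) / τ ^ (2 / (2 - γ))) ≤ phaseOneLength N T := by
    have h0 : 0 ≤ μ ^ (γ / (2 - γ)) / τ ^ (2 / (2 - γ)) :=
      div_nonneg (Real.rpow_nonneg hμ.le _) (Real.rpow_nonneg hgeo.τ_pos.le _)
    have h1 : 2 * E₀ ≤ C := by
      rw [hC]
      linarith [show 0 ≤ 8 * Ch ^ 2 * E₀ ^ 2 + 8 * A + 4 * Clam * E₀ by positivity]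
    refine le_trans ?_ hlarge
    calc 2 * (E₀ * G) * (μ ^ (γ / (2 - γ)) / τ ^ (2 / (2 - γ)))
        = 2 * E₀ * G * (μ ^ (γ / (2 - γ)) / τ ^ (2 / (2 - γ))) := by ring
      _ ≤ C * G * max (μ ^ (γ / (2 - γ)) / τ ^ (2 / (2 - γ))) (ζ / (μ * c ^ 2)) := by
        gcongr
        exact le_max_left _ _
      _ = _ := by rw [hG]; ring
  refine ofReal_one_sub_le_measure hδ.le hR.w₀_approx hbad₁ hbad₂ fun ω hmin hloss hnoise => ?_
  replace hmin := not_not.1 hmin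
  replace hloss := not_not.1 hloss (w₀ ω) hmin
  replace hnoise := not_not.1 hnoise
  have hdist : phaseOneLength N T * ‖w₀ ω - wstar‖ ^ 2 ≤ 2 * (E₀ * G) / μ := by
    refine mul_sq_le_of_min_le hμ hgeo.τ_pos hgeo.γ_pos hgeo.γ_lt hn0 (by positivity)
      (norm_nonneg _) ?_ hthr
    refine (hgeo.growth _ (hR.w₀_mem ω)).trans ?_
    have h0 : expectedLoss X f wstar wstar = 0 := by simp [expectedLoss]
    rw [h0, sub_zero, le_div_iff₀ hn0, mul_comm]
    exact hloss
  have hlamdist : lam * ‖w₀ ω - wstar‖ ^ 2 ≤ Clam * (2 * (E₀ * G) / μ) := by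
    rw [hlam, mul_assoc]
    refine mul_le_mul_of_nonneg_left (le_trans ?_ hdist) hClam.le
    exact mul_le_mul_of_nonneg_right hsqrtn (sq_nonneg _)
  have hshared : ∀ τ' ≤ N * T, ∀ t ≤ N * T, ∀ i : Fin N,
      sqNorm ((trajectoryAt f wstar w₀ x η ω).sigma f lam (sharedSet N τ' t i))
        ((trajectoryAt f wstar w₀ x η ω).estimate f lam (sharedSet N τ' t i) - wstar)
        ≤ β := by
    intro τ' hτ' t ht i
    have h1 := sqNorm_estimate_le_of_good (h := trajectoryAt f wstar w₀ x η ω)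
      (η := fun s => η s ω) (Q := N * T) hW hf hCh.le (hClam.trans_le hlam0) rfl
      (hR.w₀_mem ω) (fun s hs => by
        obtain ⟨hs1, hs2⟩ := Finset.mem_Icc.1 hs
        obtain ⟨s, rfl⟩ : ∃ r, s = r + 1 := ⟨s - 1, by omega⟩
        exact (hR.x_optimistic s (by omega) ω).1)
      (fun s => rfl) hQn hdist ht i (hnoise τ' hτ' t ht i)
    have h2 := two_mul_error_terms_le (Ch := Ch) hd' hF hι hμ (sq_nonneg (σ : ℝ)) hClam.le
      hE₀0.le hA0.le
    rw [hβ, radius]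
    refine le_trans (h1.trans ?_) h2
    exact mul_le_mul_of_nonneg_left (add_le_add le_rfl hlamdist) zero_le_two
  intro t ht
  obtain ⟨ht1, htQ⟩ := Finset.mem_Icc.1 ht
  refine ⟨?_, fun i => ?_⟩
  · obtain ⟨τ', hτ', hD⟩ :=
      (trajectoryAt f wstar w₀ x η ω).exists_activeSet_eq f lam thr N ht1
    simp only [hD]
    exact hshared τ' (hτ'.trans htQ) t htQ _
  · obtain ⟨τ', hτ', hD⟩ :=
      (trajectoryAt f wstar w₀ x η ω).exists_clientSets_cur_eq f lam thr N t
    simp only [hD i]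
    exact hshared τ' (hτ'.trans htQ) t htQ i
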